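/- For $\operatorname{Im}\tau>0$ put $q^a=e^{i\pi\tau a}$ and let $\Theta_1(u|\tau)=2\sum_{n\ge0}(-1)^nq^{(n+1/2)^2}\sin(2n+1)u$, $\Theta_2(u|\tau)=2\sum_{n\ge0}q^{(n+1/2)^2}\cos(2n+1)u$, $\Theta_3(u|\tau)=1+2\sum_{n\ge1}q^{n^2}\cos 2nu$, $\Theta_4(u|\tau)=1+2\sum_{n\ge1}(-1)^nq^{n^2}\cos 2nu$. Let $k(\tau)=\Theta_2(0|\tau)^2/\Theta_3(0|\tau)^2$ be the modulus and $k'(\tau)=\Theta_4(0|\tau)^2/\Theta_3(0|\tau)^2$ the complementary modulus. With $u=z/\Theta_3(0|\tau)^2$ put $$\mathrm{sn}(z|\tau)=\frac{\Theta_3(0|\tau)\Theta_1(u|\tau)}{\Theta_2(0|\tau)\Theta_4(u|\tau)},\quad \mathrm{cn}(z|\tau)=\frac{\Theta_4(0|\tau)\Theta_2(u|\tau)}{\Theta_2(0|\tau)\Theta_4(u|\tau)},\quad \mathrm{dn}(z|\tau)=\frac{\Theta_4(0|\tau)\Theta_3(u|\tau)}{\Theta_3(0|\tau)\Theta_4(u|\tau)}.$$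 For a number $k$ of the form $k(\tau)$ write $\mathrm{sn}(z;k)=\mathrm{sn}(z|\tau)$, etc., for a choice of $\tau$ with $k(\tau)=k$, and let $\mathrm{ns}=1/\mathrm{sn}$, $\mathrm{nc}=1/\mathrm{cn}$, $\mathrm{nd}=1/\mathrm{dn}$, $\mathrm{sc}=\mathrm{sn}/\mathrm{cn}$, $\mathrm{sd}=\mathrm{sn}/\mathrm{dn}$, $\mathrm{cd}=\mathrm{cn}/\mathrm{dn}$, $\mathrm{cs}=\mathrm{cn}/\mathrm{sn}$, $\mathrm{ds}=\mathrm{dn}/\mathrm{sn}$, $\mathrm{dc}=\mathrm{dn}/\mathrm{cn}$, as meromorphic functions on $\mathbb C$. The normalized Cayley–Klein (CK) algebra with curvatures $(\kappa_1,\kappa_2)$ is given by $[J,P_1]=P_2$, $[J,P_2]=-\kappa_2P_1$, $[P_1,P_2]=\kappa_1J$; it is elliptic, hyperbolic, co-hyperbolic, doubly hyperbolic for $(\kappa_1,\kappa_2)=(1,1),(-1,1),(1,-1),(-1,-1)$ respectively. A (Witt) realization consists of three vector fields $f\frac{d}{dz}$ on $\mathbb C$ with meromorphic coefficients, linearly independent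 over $\mathbb C$, that satisfy these relations for the bracket $[f\frac d{dz},g\frac d{dz}]=(fg'-gf')\frac d{dz}$. **Claim.** (0) The functions $\mathrm{sn}(\cdot|\tau),\mathrm{cn}(\cdot|\tau),\mathrm{dn}(\cdot|\tau)$ depend on $\tau$ only through $k(\tau)$. For every $k\in(0,1)$ there is $t>0$ with $k(it)=k$ and $k'(it)=\sqrt{1-k^2}$. (1) Let $\operatorname{Im}\tau>0$, $k=k(\tau)$, $k'=k'(\tau)$. Then $k(-1/\tau)=k'$, $k'(-1/\tau)=k$ and, with $\zeta=iz$, as meromorphic functions of $z$, $$\begin{array}{lll} \mathrm{sc}(z;k')=-i\,\mathrm{sn}(\zeta;k), & \mathrm{nc}(z;k')=\mathrm{cn}(\zeta;k), & \mathrm{dc}(z;k')=\mathrm{dn}(\zeta;k),\\ \mathrm{cs}(z;k')=i\,\mathrm{ns}(\zeta;k), & \mathrm{ds}(z;k')=i\,\mathrm{ds}(\zeta;k), & \mathrm{ns}(z;k')=i\,\mathrm{cs}(\zeta;k),\\ \mathrm{nd}(z;k')=\mathrm{cd}(\zeta;k), & \mathrm{cd}(z;k')=\mathrm{nd}(\zeta;k),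 & \mathrm{sd}(z;k')=-i\,\mathrm{sd}(\zeta;k),\\ \mathrm{cn}(z;k')=\mathrm{nc}(\zeta;k), & \mathrm{sn}(z;k')=-i\,\mathrm{sc}(\zeta;k), & \mathrm{dn}(z;k')=\mathrm{dc}(\zeta;k). \end{array}$$ (2) In the same situation $k^2+k'^2=1$, $k,k'\ne0$, and with $\lambda=ik/k'$ one has $k(\tau+1)=\lambda$, $k'(\tau+1)=1/k'$ and $$\mathrm{sd}(z;k)=\tfrac1{k'}\mathrm{sn}(k'z;\lambda),\quad \mathrm{cd}(z;k)=\mathrm{cn}(k'z;\lambda),\quad \mathrm{nd}(z;k)=\mathrm{dn}(k'z;\lambda).$$ (3) Let $0<k<1$ and $k'=\sqrt{1-k^2}$. The following triples of coefficients $(J,P_1,P_2)$, in which all functions are taken at $(z;k')$, give realizations of the elliptic (E), hyperbolic (H), co-hyperbolic (C) and doubly hyperbolic (D) algebra: * E: $(-\frac{\mathrm{dn}}{k},\frac{i\,\mathrm{cn}}{k},i\,\mathrm{sn})$; H: $(-\frac{\mathrm{dn}}{k},\frac{\mathrm{cn}}{k},\mathrm{sn})$; C: $(\frac{\mathrm{cn}}{k},\frac{\mathrm{dn}}{k},\mathrm{sn})$;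 D: $(\mathrm{sn},-\frac{i\,\mathrm{dn}}{k},\frac{i\,\mathrm{cn}}{k})$. * E: $(\frac{i\,\mathrm{dc}}{k'},\frac{\mathrm{nc}}{k'},i\,\mathrm{sc})$; H: $(\frac{i\,\mathrm{dc}}{k'},-\mathrm{sc},-\frac{i\,\mathrm{nc}}{k'})$; C: $(\frac{\mathrm{dc}}{k'},\frac{\mathrm{nc}}{k'},\mathrm{sc})$; D: $(\frac{\mathrm{dc}}{k'},\frac{i\,\mathrm{nc}}{k'},i\,\mathrm{sc})$. * E: $(\frac{i\,\mathrm{ns}}{k'},\frac{i\,\mathrm{cs}}{k},\frac{\mathrm{ds}}{kk'})$; H: $(\frac{\mathrm{ds}}{kk'},\frac{\mathrm{ns}}{k'},\frac{\mathrm{cs}}{k})$; C: $(\frac{\mathrm{cs}}{k},\frac{\mathrm{ds}}{kk'},\frac{\mathrm{ns}}{k'})$; D: $(\frac{\mathrm{ns}}{k'},\frac{\mathrm{cs}}{k},-\frac{\mathrm{ds}}{kk'})$. * E: $(-\mathrm{nd},i\,\mathrm{cd},i\,\mathrm{sd})$; H: $(\mathrm{nd},\mathrm{sd},\mathrm{cd})$;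 C: $(i\,\mathrm{nd},i\,\mathrm{sd},-\mathrm{cd})$; D: $(\mathrm{sd},-i\,\mathrm{nd},i\,\mathrm{cd})$. They remain realizations when they are written in the coordinate $\zeta=iz$, where by (1) they are expressed through Jacobi functions of modulus $k$; for instance the elliptic triple of the second family becomes $\{-\frac1{k'}\mathrm{dn}(\zeta;k)\frac{d}{d\zeta},\ \frac{i}{k'}\mathrm{cn}(\zeta;k)\frac{d}{d\zeta},\ i\,\mathrm{sn}(\zeta;k)\frac{d}{d\zeta}\}$. (4) Let $0<k<1$, $k'=\sqrt{1-k^2}$, $\lambda=ik/k'$. Written in the coordinate $u=k'z$, the triples of the last family in (3) with modulus $k$ instead of $k'$ become, with all functions at $(u;\lambda)$, E: $(-k'\mathrm{dn},ik'\mathrm{cn},i\,\mathrm{sn})$; H: $(k'\mathrm{dn},\mathrm{sn},k'\mathrm{cn})$; C: $(ik'\mathrm{dn},i\,\mathrm{sn},-k'\mathrm{cn})$; D: $(\mathrm{sn},-ik'\mathrm{dn},ik'\mathrm{cn})$, and these are realizations of the four CK-algebras. As $k$ runs through $(0,1)$, $|\lambda|$ takes exactly the values in $(0,\infty)$. -/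

import Mathlib

open Complex

noncomputable section

namespace JacobiElliptic

/-- The power `q ^ a` of the nome `q = exp (iπτ)`, with the branch `exp (iπτa)`. -/
def nomePow (τ a : ℂ) : ℂ := Complex.exp (Real.pi * I * τ * a)

/-- The theta function `Θ₁(u|τ) = 2 ∑_{n ≥ 0} (-1)ⁿ q^((n+1/2)²) sin((2n+1)u)`. -/
def theta1 (u τ : ℂ) : ℂ :=
  2 * ∑' n : ℕ, (-1) ^ n * nomePow τ (((n : ℂ) + 1 / 2) ^ 2) * Complex.sin ((2 * (n : ℂ) + 1) * u)

/-- The theta function `Θ₂(u|τ) = 2 ∑_{n ≥ 0} q^((n+1/2)²) cos((2n+1)u)`. -/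
def theta2 (u τ : ℂ) : ℂ :=
  2 * ∑' n : ℕ, nomePow τ (((n : ℂ) + 1 / 2) ^ 2) * Complex.cos ((2 * (n : ℂ) + 1) * u)

/-- The theta function `Θ₃(u|τ) = 1 + 2 ∑_{n ≥ 1} q^(n²) cos(2nu)`. -/
def theta3 (u τ : ℂ) : ℂ :=
  1 + 2 * ∑' n : ℕ, nomePow τ (((n : ℂ) + 1) ^ 2) * Complex.cos (2 * ((n : ℂ) + 1) * u)

/-- The theta function `Θ₄(u|τ) = 1 + 2 ∑_{n ≥ 1} (-1)ⁿ q^(n²) cos(2nu)`. -/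
def theta4 (u τ : ℂ) : ℂ :=
  1 + 2 * ∑' n : ℕ,
    (-1) ^ (n + 1) * nomePow τ (((n : ℂ) + 1) ^ 2) * Complex.cos (2 * ((n : ℂ) + 1) * u)

/-- The modulus `k = Θ₂(0|τ)² / Θ₃(0|τ)²`. -/
def modulus (τ : ℂ) : ℂ := theta2 0 τ ^ 2 / theta3 0 τ ^ 2

/-- The complementary modulus `k' = Θ₄(0|τ)² / Θ₃(0|τ)²`. -/
def comodulus (τ : ℂ) : ℂ := theta4 0 τ ^ 2 / theta3 0 τ ^ 2

/-- The meromorphic function on `ℂ` given by an expression that is meromorphic: removable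
singularities are filled in and the value at a pole is `0`. Two functions of this form that agree
off a discrete set are equal. -/
def regularize (f : ℂ → ℂ) : ℂ → ℂ := toMeromorphicNFOn f Set.univ

/-- `sn(z|τ)`; the theta functions are taken at `u = z / Θ₃(0|τ)²`. -/
def snTau (τ : ℂ) : ℂ → ℂ := regularize fun z =>
  theta3 0 τ / theta2 0 τ * (theta1 (z / theta3 0 τ ^ 2) τ / theta4 (z / theta3 0 τ ^ 2) τ)

/-- `cn(z|τ)`. -/
def cnTau (τ : ℂ) : ℂ → ℂ := regularize fun z =>
  theta4 0 τ / theta2 0 τ * (theta2 (z / theta3 0 τ ^ 2) τ / theta4 (z / theta3 0 τ ^ 2) τ)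

/-- `dn(z|τ)`. -/
def dnTau (τ : ℂ) : ℂ → ℂ := regularize fun z =>
  theta4 0 τ / theta3 0 τ * (theta3 (z / theta3 0 τ ^ 2) τ / theta4 (z / theta3 0 τ ^ 2) τ)

/-- A point `τ` of the upper half-plane whose modulus is `k` (arbitrary if there is none). -/
def tauOf (k : ℂ) : ℂ := Classical.epsilon fun τ : ℂ => 0 < τ.im ∧ modulus τ = k

/-! The Jacobi functions of modulus `k`, and their reciprocals and quotients. -/

/-- `sn(z; k)`. -/
def sn (k : ℂ) : ℂ → ℂ := snTau (tauOf k)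

/-- `cn(z; k)`. -/
def cn (k : ℂ) : ℂ → ℂ := cnTau (tauOf k)

/-- `dn(z; k)`. -/
def dn (k : ℂ) : ℂ → ℂ := dnTau (tauOf k)

def ns (k : ℂ) : ℂ → ℂ := regularize fun z => 1 / sn k z
def nc (k : ℂ) : ℂ → ℂ := regularize fun z => 1 / cn k z
def nd (k : ℂ) : ℂ → ℂ := regularize fun z => 1 / dn k z
def sc (k : ℂ) : ℂ → ℂ := regularize fun z => sn k z / cn k z
def sd (k : ℂ) : ℂ → ℂ := regularize fun z => sn k z / dn k z
def cd (k : ℂ) : ℂ → ℂ := regularize fun z => cn k z / dn k z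
def cs (k : ℂ) : ℂ → ℂ := regularize fun z => cn k z / sn k z
def ds (k : ℂ) : ℂ → ℂ := regularize fun z => dn k z / sn k z
def dc (k : ℂ) : ℂ → ℂ := regularize fun z => dn k z / cn k z

/-! Cayley-Klein algebras and their realizations by meromorphic vector fields. -/

/-- The four normalized Cayley-Klein algebras with non-vanishing curvatures. -/
inductive CKType where
  | elliptic
  | hyperbolic
  | coHyperbolic
  | doublyHyperbolic

/-- The curvature `κ₁`. -/
def CKType.curv1 : CKType → ℂ
  | .elliptic => 1
  | .hyperbolic => -1
  | .coHyperbolic => 1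
  | .doublyHyperbolic => -1

/-- The curvature `κ₂`. -/
def CKType.curv2 : CKType → ℂ
  | .elliptic => 1
  | .hyperbolic => 1
  | .coHyperbolic => -1
  | .doublyHyperbolic => -1

/-- The coefficient functions of three vector fields `J d/dz`, `P₁ d/dz`, `P₂ d/dz`. -/
structure Generators where
  J : ℂ → ℂ
  P₁ : ℂ → ℂ
  P₂ : ℂ → ℂ

/-- The coefficient `f g' - g f'` of the commutator `[f d/dz, g d/dz]`. -/
def wittBracket (f g : ℂ → ℂ) : ℂ → ℂ := fun z => f z * deriv g z - g z * deriv f z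

/-- The vector fields are meromorphic on `ℂ`, linearly independent over `ℂ`, and satisfy
`[J, P₁] = P₂`, `[J, P₂] = -κ₂ P₁`, `[P₁, P₂] = κ₁ J`. As usual, meromorphic functions are equal
when they agree off a (closed) discrete set. -/
structure IsWittRealization (T : CKType) (G : Generators) : Prop where
  meromorphic_J : Meromorphic G.J
  meromorphic_P₁ : Meromorphic G.P₁
  meromorphic_P₂ : Meromorphic G.P₂
  bracket_J_P₁ : wittBracket G.J G.P₁ =ᶠ[Filter.codiscrete ℂ] G.P₂
  bracket_J_P₂ : wittBracket G.J G.P₂ =ᶠ[Filter.codiscrete ℂ] fun z => -T.curv2 * G.P₁ z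
  bracket_P₁_P₂ : wittBracket G.P₁ G.P₂ =ᶠ[Filter.codiscrete ℂ] fun z => T.curv1 * G.J z
  independent : ∀ a b c : ℂ,
    (fun z => a * G.J z + b * G.P₁ z + c * G.P₂ z) =ᶠ[Filter.codiscrete ℂ] (fun _ => 0) →
      a = 0 ∧ b = 0 ∧ c = 0

/-- The same vector fields in the coordinate `u = c z`: since `d/dz = c d/du`, the coefficient
`f` becomes `u ↦ c f(u / c)`. -/
def Generators.changeVar (c : ℂ) (G : Generators) : Generators where
  J := fun u => c * G.J (u / c)
  P₁ := fun u => c * G.P₁ (u / c)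
  P₂ := fun u => c * G.P₂ (u / c)

/-! In the next four families `k` is the modulus and `k'` the complementary modulus. -/

def basicFamily (k k' : ℂ) : CKType → Generators
  | .elliptic => ⟨fun z => -dn k z / k', fun z => I * cn k z / k', fun z => I * sn k z⟩
  | .hyperbolic => ⟨fun z => -dn k z / k', fun z => cn k z / k', fun z => sn k z⟩
  | .coHyperbolic => ⟨fun z => cn k z / k', fun z => dn k z / k', fun z => sn k z⟩
  | .doublyHyperbolic => ⟨fun z => sn k z, fun z => -I * dn k z / k', fun z => I * cn k z / k'⟩

def cFamily (k : ℂ) : CKType → Generators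
  | .elliptic => ⟨fun z => I * dc k z / k, fun z => nc k z / k, fun z => I * sc k z⟩
  | .hyperbolic => ⟨fun z => I * dc k z / k, fun z => -sc k z, fun z => -I * nc k z / k⟩
  | .coHyperbolic => ⟨fun z => dc k z / k, fun z => nc k z / k, fun z => sc k z⟩
  | .doublyHyperbolic => ⟨fun z => dc k z / k, fun z => I * nc k z / k, fun z => I * sc k z⟩

def sFamily (k k' : ℂ) : CKType → Generators
  | .elliptic => ⟨fun z => I * ns k z / k, fun z => I * cs k z / k', fun z => ds k z / (k * k')⟩
  | .hyperbolic => ⟨fun z => ds k z / (k * k'), fun z => ns k z / k, fun z => cs k z / k'⟩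
  | .coHyperbolic => ⟨fun z => cs k z / k', fun z => ds k z / (k * k'), fun z => ns k z / k⟩
  | .doublyHyperbolic =>
      ⟨fun z => ns k z / k, fun z => cs k z / k', fun z => -ds k z / (k * k')⟩

def dFamily (k : ℂ) : CKType → Generators
  | .elliptic => ⟨fun z => -nd k z, fun z => I * cd k z, fun z => I * sd k z⟩
  | .hyperbolic => ⟨fun z => nd k z, fun z => sd k z, fun z => cd k z⟩
  | .coHyperbolic => ⟨fun z => I * nd k z, fun z => I * sd k z, fun z => -cd k z⟩
  | .doublyHyperbolic => ⟨fun z => sd k z, fun z => -I * nd k z, fun z => I * cd k z⟩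

/-- Vector fields built from the Jacobi functions of modulus `l`. -/
def lambdaFamily (l k' : ℂ) : CKType → Generators
  | .elliptic => ⟨fun u => -k' * dn l u, fun u => I * k' * cn l u, fun u => I * sn l u⟩
  | .hyperbolic => ⟨fun u => k' * dn l u, fun u => sn l u, fun u => k' * cn l u⟩
  | .coHyperbolic => ⟨fun u => I * k' * dn l u, fun u => I * sn l u, fun u => -k' * cn l u⟩
  | .doublyHyperbolic => ⟨fun u => sn l u, fun u => -I * k' * dn l u, fun u => I * k' * cn l u⟩

end JacobiElliptic

end

open JacobiElliptic

/-!
The addition formulas expressing products of theta functions at `τ` through theta functions at `2τ`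
give all the quadratic relations needed between the theta functions. They also show that
`θ₁'(0) / (θ₂(0) θ₃(0) θ₄(0))` is invariant under `τ ↦ 2τ`; as it tends to `1` when `Im τ → ∞`, it
equals `1`, which is Jacobi's derivative formula. Hence `(sn, cn, dn)` solves

  `s' = c d`, `c² + s² = 1`, `d² + k² s² = 1`, `(s, c, d)(0) = (0, 1, 1)`,

and these conditions determine the triple. The triples obtained by dividing by `c` or by `d` and by
rescaling the variable solve a system of the same shape with other coefficients, so every
transformation formula is an instance of uniqueness once the action of `τ ↦ -1/τ` and `τ ↦ τ + 1` on
the moduli is known. The brackets of two entries of such a triple are multiples of the third entry,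
and so it is for `(1 / s, c / s, d / s)`; ordering and rescaling the entries gives all realizations.
-/

namespace JacobiElliptic

open Filter Topology
open scoped Real ComplexConjugate

/-! ### Theta functions -/

theorem hasSum_jacobiTheta₂_term_add_neg {τ : ℂ} (hτ : 0 < τ.im) (z : ℂ) :
    HasSum (fun n : ℕ => jacobiTheta₂_term n z τ + jacobiTheta₂_term (-(n + 1)) z τ)
      (jacobiTheta₂ z τ) :=
  (hasSum_jacobiTheta₂_term z hτ).nat_add_neg_add_one

theorem jacobiTheta₂_term_eq_nomePow (n : ℤ) (u τ : ℂ) :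
    jacobiTheta₂_term n (u / π) τ = nomePow τ (n ^ 2) * exp (2 * n * u * I) := by
  rw [jacobiTheta₂_term, nomePow, ← exp_add]
  congr 1
  field_simp
  ring

theorem theta3_eq_jacobiTheta₂ {τ : ℂ} (hτ : 0 < τ.im) (u : ℂ) :
    theta3 u τ = jacobiTheta₂ (u / π) τ := by
  have hfold := (hasSum_jacobiTheta₂_term (u / π) hτ).nat_add_neg
  rw [← hasSum_nat_add_iff' 1] at hfold
  have hterm (n : ℕ) : jacobiTheta₂_term ((n + 1 : ℕ) : ℤ) (u / π) τ +
      jacobiTheta₂_term (-(n + 1 : ℕ)) (u / π) τ =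
      2 * (nomePow τ (((n : ℂ) + 1) ^ 2) * Complex.cos (2 * ((n : ℂ) + 1) * u)) := by
    rw [jacobiTheta₂_term_eq_nomePow, jacobiTheta₂_term_eq_nomePow, Complex.cos]
    push_cast
    ring_nf
  simp only [hterm, Finset.range_one, Finset.sum_singleton, Nat.cast_zero, neg_zero] at hfold
  rw [theta3, ← tsum_mul_left, hfold.tsum_eq]
  simp [jacobiTheta₂_term]

theorem theta2_eq_theta3 {τ : ℂ} (hτ : 0 < τ.im) (u : ℂ) :
    theta2 u τ = exp (π * I * τ / 4 + I * u) * theta3 (u + π * τ / 2) τ := by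
  have hterm (n : ℕ) : exp (π * I * τ / 4 + I * u) *
      (jacobiTheta₂_term n ((u + π * τ / 2) / π) τ +
        jacobiTheta₂_term (-(n + 1)) ((u + π * τ / 2) / π) τ) =
      2 * (nomePow τ (((n : ℂ) + 1 / 2) ^ 2) * Complex.cos ((2 * (n : ℂ) + 1) * u)) := by
    rw [jacobiTheta₂_term_eq_nomePow, jacobiTheta₂_term_eq_nomePow, Complex.cos, nomePow, nomePow,
      nomePow, mul_add, ← exp_add, ← exp_add, ← exp_add, ← exp_add, mul_left_comm 2,
      mul_div_cancel₀ _ (two_ne_zero' ℂ), mul_add (exp _), ← exp_add, ← exp_add]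
    push_cast
    ring_nf
  have hfold := (hasSum_jacobiTheta₂_term_add_neg hτ ((u + π * τ / 2) / π)).mul_left
    (exp (π * I * τ / 4 + I * u))
  simp only [hterm] at hfold
  rw [theta2, ← tsum_mul_left, hfold.tsum_eq, theta3_eq_jacobiTheta₂ hτ]

theorem theta1_eq_theta2 (u τ : ℂ) : theta1 u τ = theta2 (u - π / 2) τ := by
  rw [theta1, theta2]
  congr 1
  refine tsum_congr fun n => ?_
  rw [show (2 * (n : ℂ) + 1) * (u - π / 2) = ((2 * n + 1) * u - π / 2) - n * π by ring,
    Complex.cos_antiperiodic.sub_nat_mul_eq, Complex.cos_sub_pi_div_two]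
  ring

theorem theta4_eq_theta3 (u τ : ℂ) : theta4 u τ = theta3 (u + π / 2) τ := by
  rw [theta3, theta4]
  congr 2
  refine tsum_congr fun n => ?_
  rw [show 2 * ((n : ℂ) + 1) * (u + π / 2) = 2 * (n + 1) * u + (n + 1 : ℕ) * π by
    push_cast; ring, Complex.cos_antiperiodic.add_nat_mul_eq]
  ring

theorem theta1_neg (u τ : ℂ) : theta1 (-u) τ = -theta1 u τ := by
  simp [theta1, tsum_neg]

theorem theta2_neg (u τ : ℂ) : theta2 (-u) τ = theta2 u τ := by
  simp [theta2]

theorem theta1_zero (τ : ℂ) : theta1 0 τ = 0 := by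
  simp [theta1]

theorem theta2_sub_pi (u τ : ℂ) : theta2 (u - π) τ = -theta2 u τ := by
  rw [theta2, theta2, ← mul_neg, ← tsum_neg]
  congr 1
  refine tsum_congr fun n => ?_
  rw [show (2 * (n : ℂ) + 1) * (u - π) = (2 * n + 1) * u - (2 * n + 1 : ℕ) * π by push_cast; ring,
    Complex.cos_antiperiodic.sub_nat_mul_eq, (odd_two_mul_add_one n).neg_one_pow]
  ring

theorem theta3_add_pi (u τ : ℂ) : theta3 (u + π) τ = theta3 u τ := by
  rw [theta3, theta3]
  congr 2
  refine tsum_congr fun n => ?_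
  rw [show 2 * ((n : ℂ) + 1) * (u + π) = 2 * (n + 1) * u + (n + 1 : ℕ) * (2 * π) by
    push_cast; ring, Complex.cos_periodic.nat_mul _]

theorem theta3_add_pi_mul {τ : ℂ} (hτ : 0 < τ.im) (u : ℂ) :
    theta3 (u + π * τ) τ = exp (-(π * I * τ + 2 * I * u)) * theta3 u τ := by
  rw [theta3_eq_jacobiTheta₂ hτ, theta3_eq_jacobiTheta₂ hτ, add_div,
    mul_div_cancel_left₀ _ (ofReal_ne_zero.2 Real.pi_ne_zero), jacobiTheta₂_add_left']
  congr 2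
  field_simp

theorem exp_mul_theta4_add {τ : ℂ} (hτ : 0 < τ.im) (u : ℂ) :
    exp (π * I * τ / 4 + I * u) * theta4 (u + π * τ / 2) τ = I * theta1 u τ := by
  rw [theta1_eq_theta2, theta2_eq_theta3 hτ, theta4_eq_theta3, ← theta3_add_pi (u - π / 2 + _),
    show u - π / 2 + π * τ / 2 + π = u + π * τ / 2 + π / 2 by ring,
    show (π : ℂ) * I * τ / 4 + I * (u - π / 2) = (π * I * τ / 4 + I * u) - π / 2 * I by ring,
    exp_sub, exp_pi_div_two_mul_I, ← mul_assoc, mul_div_cancel₀ _ I_ne_zero]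

theorem differentiable_theta3 {τ : ℂ} (hτ : 0 < τ.im) : Differentiable ℂ fun u => theta3 u τ := by
  have hjacobi : Differentiable ℂ fun z => jacobiTheta₂ z τ :=
    fun z => differentiableAt_jacobiTheta₂_fst z hτ
  simp only [theta3_eq_jacobiTheta₂ hτ]
  exact hjacobi.comp (by fun_prop)

theorem differentiable_theta4 {τ : ℂ} (hτ : 0 < τ.im) : Differentiable ℂ fun u => theta4 u τ := by
  simp only [theta4_eq_theta3]
  exact (differentiable_theta3 hτ).comp (by fun_prop)

theorem differentiable_theta2 {τ : ℂ} (hτ : 0 < τ.im) : Differentiable ℂ fun u => theta2 u τ := by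
  have hshift : Differentiable ℂ fun u => theta3 (u + π * τ / 2) τ :=
    (differentiable_theta3 hτ).comp (by fun_prop)
  simp only [theta2_eq_theta3 hτ]
  fun_prop

theorem differentiable_theta1 {τ : ℂ} (hτ : 0 < τ.im) : Differentiable ℂ fun u => theta1 u τ := by
  simp only [theta1_eq_theta2]
  exact (differentiable_theta2 hτ).comp (by fun_prop)

theorem deriv_theta2_zero (τ : ℂ) : deriv (fun u => theta2 u τ) 0 = 0 := by
  have h := deriv_comp_neg (fun u => theta2 u τ) 0
  simp only [theta2_neg, neg_zero] at h
  exact CharZero.eq_neg_self_iff.1 h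

/-! ### Doubling formulas -/

theorem hasSum_jacobiTheta₂_term_mul_jacobiTheta₂_term {τ : ℂ} (hτ : 0 < τ.im) (z w : ℂ) :
    HasSum (fun p : ℤ × ℤ => jacobiTheta₂_term p.1 z τ * jacobiTheta₂_term p.2 w τ)
      (jacobiTheta₂ z τ * jacobiTheta₂ w τ) := by
  have hsummable (z : ℂ) : Summable fun n => ‖jacobiTheta₂_term n z τ‖ :=
    ((summable_jacobiTheta₂_term_iff z τ).mpr hτ).norm
  rw [jacobiTheta₂, jacobiTheta₂, tsum_mul_tsum_of_summable_norm (hsummable z) (hsummable w)]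
  exact (summable_mul_of_summable_norm (hsummable z) (hsummable w)).hasSum

theorem jacobiTheta₂_term_add_half (n : ℤ) (z τ : ℂ) :
    jacobiTheta₂_term n (z + 1 / 2) τ = (-1) ^ n * jacobiTheta₂_term n z τ := by
  rw [jacobiTheta₂_term, jacobiTheta₂_term, ← exp_pi_mul_I, ← exp_int_mul, ← exp_add]
  ring_nf

theorem jacobiTheta₂_term_two_mul_mul (a b : ℤ) (z w τ : ℂ) :
    jacobiTheta₂_term a (z + w) (2 * τ) * jacobiTheta₂_term b (z - w) (2 * τ) =
      jacobiTheta₂_term (a + b) z τ * jacobiTheta₂_term (a - b) w τ := by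
  simp only [jacobiTheta₂_term, ← exp_add]
  push_cast
  ring_nf

theorem injective_add_sub : Function.Injective fun p : ℤ × ℤ => (p.1 + p.2, p.1 - p.2) := by
  rintro ⟨a, b⟩ ⟨c, d⟩ h
  simp only [Prod.mk.injEq] at h ⊢
  lia

theorem mem_range_add_sub_iff (p : ℤ × ℤ) :
    p ∈ Set.range (fun p : ℤ × ℤ => (p.1 + p.2, p.1 - p.2)) ↔ Even (p.1 + p.2) := by
  constructor
  · rintro ⟨⟨a, b⟩, rfl⟩
    exact ⟨a, by ring⟩
  · rintro ⟨a, ha⟩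
    exact ⟨(a, p.1 - a), Prod.ext (by ring) (by grind)⟩

-- In the product of the two series on the right, `1 + (-1) ^ (m + n)` selects the pairs `(m, n)`
-- with `m + n` even, which are exactly the pairs `(a + b, a - b)`.
theorem jacobiTheta₂_mul_jacobiTheta₂_two_mul {τ : ℂ} (hτ : 0 < τ.im) (z w : ℂ) :
    2 * (jacobiTheta₂ (z + w) (2 * τ) * jacobiTheta₂ (z - w) (2 * τ)) =
      jacobiTheta₂ z τ * jacobiTheta₂ w τ +
        jacobiTheta₂ (z + 1 / 2) τ * jacobiTheta₂ (w + 1 / 2) τ := by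
  have hτ2 : 0 < (2 * τ).im := by simpa using hτ
  have hsum := (hasSum_jacobiTheta₂_term_mul_jacobiTheta₂_term hτ z w).add
    (hasSum_jacobiTheta₂_term_mul_jacobiTheta₂_term hτ (z + 1 / 2) (w + 1 / 2))
  have hterm (p : ℤ × ℤ) : jacobiTheta₂_term p.1 z τ * jacobiTheta₂_term p.2 w τ +
      jacobiTheta₂_term p.1 (z + 1 / 2) τ * jacobiTheta₂_term p.2 (w + 1 / 2) τ =
      (1 + (-1) ^ (p.1 + p.2)) * (jacobiTheta₂_term p.1 z τ * jacobiTheta₂_term p.2 w τ) := by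
    rw [jacobiTheta₂_term_add_half, jacobiTheta₂_term_add_half, zpow_add₀ (by norm_num)]
    ring
  simp only [hterm] at hsum
  rw [← injective_add_sub.hasSum_iff] at hsum
  · refine ((hasSum_jacobiTheta₂_term_mul_jacobiTheta₂_term hτ2 (z + w) (z - w)).mul_left 2).unique
      (hsum.congr_fun fun p => ?_)
    rw [jacobiTheta₂_term_two_mul_mul, Function.comp,
      ((mem_range_add_sub_iff _).1 ⟨p, rfl⟩).neg_one_zpow, one_add_one_eq_two]
  · intro p hp
    rw [mem_range_add_sub_iff, Int.not_even_iff_odd] at hp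
    rw [hp.neg_one_zpow, add_neg_cancel, zero_mul]

theorem theta3_mul_theta3_two_mul {τ : ℂ} (hτ : 0 < τ.im) (x y : ℂ) :
    2 * (theta3 (x + y) (2 * τ) * theta3 (x - y) (2 * τ)) =
      theta3 x τ * theta3 y τ + theta4 x τ * theta4 y τ := by
  have hτ2 : 0 < (2 * τ).im := by simpa using hτ
  have hhalf (u : ℂ) : (u + π / 2) / π = u / π + 1 / 2 := by field_simp
  simp only [theta4_eq_theta3, theta3_eq_jacobiTheta₂ hτ2, theta3_eq_jacobiTheta₂ hτ, hhalf,
    add_div _ _ (π : ℂ), sub_div, jacobiTheta₂_mul_jacobiTheta₂_two_mul hτ]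

theorem theta4_mul_theta4_two_mul {τ : ℂ} (hτ : 0 < τ.im) (x y : ℂ) :
    2 * (theta4 (x + y) (2 * τ) * theta4 (x - y) (2 * τ)) =
      theta4 x τ * theta3 y τ + theta3 x τ * theta4 y τ := by
  have h := theta3_mul_theta3_two_mul hτ (x + π / 2) y
  rwa [theta4_eq_theta3 (x + π / 2), add_assoc x (π / 2 : ℂ) (π / 2), add_halves, theta3_add_pi,
    add_right_comm, add_sub_right_comm, ← theta4_eq_theta3, ← theta4_eq_theta3,
    ← theta4_eq_theta3] at h

theorem theta2_mul_theta2_two_mul {τ : ℂ} (hτ : 0 < τ.im) (x y : ℂ) :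
    2 * (theta2 (x + y) (2 * τ) * theta2 (x - y) (2 * τ)) =
      theta3 x τ * theta3 y τ - theta4 x τ * theta4 y τ := by
  have hτ2 : 0 < (2 * τ).im := by simpa using hτ
  have h := theta3_mul_theta3_two_mul hτ (x + π * τ) y
  have hcancel : exp (π * I * τ + 2 * I * x) * exp (-(π * I * τ + 2 * I * x)) = 1 := by
    rw [← exp_add, add_neg_cancel, exp_zero]
  have hneg : exp (-(π * I * τ + 2 * I * (x + π / 2))) = -exp (-(π * I * τ + 2 * I * x)) := by
    rw [show -(π * I * τ + 2 * I * (x + π / 2)) = -(π * I * τ + 2 * I * x) - π * I by ring,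
      exp_sub_pi_mul_I]
  have hexp : exp (π * I * (2 * τ) / 4 + I * (x + y)) * exp (π * I * (2 * τ) / 4 + I * (x - y)) =
      exp (π * I * τ + 2 * I * x) := by
    rw [← exp_add]
    ring_nf
  rw [theta4_eq_theta3 (x + π * τ), add_right_comm x _ (π / 2 : ℂ), theta3_add_pi_mul hτ,
    theta3_add_pi_mul hτ, ← theta4_eq_theta3, hneg] at h
  rw [theta2_eq_theta3 hτ2, theta2_eq_theta3 hτ2, mul_mul_mul_comm, hexp,
    show x + y + π * (2 * τ) / 2 = x + π * τ + y by ring,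
    show x - y + π * (2 * τ) / 2 = x + π * τ - y by ring]
  linear_combination exp (π * I * τ + 2 * I * x) * h +
    (theta3 x τ * theta3 y τ - theta4 x τ * theta4 y τ) * hcancel

theorem theta2_mul_theta3_two_mul {τ : ℂ} (hτ : 0 < τ.im) (x y : ℂ) :
    2 * (theta2 (x + y) (2 * τ) * theta3 (x - y) (2 * τ)) =
      theta2 x τ * theta2 y τ - theta1 x τ * theta1 y τ := by
  have hτ2 : 0 < (2 * τ).im := by simpa using hτ
  have h := theta3_mul_theta3_two_mul hτ (x + π * τ / 2) (y + π * τ / 2)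
  rw [show x + π * τ / 2 + (y + π * τ / 2) = x + y + π * (2 * τ) / 2 by ring,
    add_sub_add_right_eq_sub] at h
  have hexp : exp (π * I * (2 * τ) / 4 + I * (x + y)) =
      exp (π * I * τ / 4 + I * x) * exp (π * I * τ / 4 + I * y) := by
    rw [← exp_add]
    ring_nf
  rw [theta2_eq_theta3 hτ2, theta2_eq_theta3 hτ, theta2_eq_theta3 hτ, hexp]
  linear_combination exp (π * I * τ / 4 + I * x) * exp (π * I * τ / 4 + I * y) * h +
    exp (π * I * τ / 4 + I * y) * theta4 (y + π * τ / 2) τ * exp_mul_theta4_add hτ x +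
    I * theta1 x τ * exp_mul_theta4_add hτ y + theta1 x τ * theta1 y τ * I_sq

theorem theta1_mul_theta4_two_mul {τ : ℂ} (hτ : 0 < τ.im) (x y : ℂ) :
    2 * (theta1 (x + y) (2 * τ) * theta4 (x - y) (2 * τ)) =
      theta1 x τ * theta2 y τ + theta2 x τ * theta1 y τ := by
  have h := theta2_mul_theta3_two_mul hτ (x - π / 2) y
  rw [theta1_eq_theta2 (x - π / 2), sub_sub x (π / 2 : ℂ) (π / 2), add_halves, theta2_sub_pi,
    ← theta1_eq_theta2, show x - π / 2 + y = x + y - π / 2 by ring, ← theta1_eq_theta2,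
    ← theta3_add_pi (x - π / 2 - y), show x - π / 2 - y + π = x - y + π / 2 by ring,
    ← theta4_eq_theta3] at h
  linear_combination h

theorem theta1_sq {τ : ℂ} (hτ : 0 < τ.im) (u : ℂ) :
    theta1 u τ ^ 2 = theta2 0 (2 * τ) * theta3 (2 * u) (2 * τ) -
      theta3 0 (2 * τ) * theta2 (2 * u) (2 * τ) := by
  have hplus := theta2_mul_theta3_two_mul hτ u u
  have hminus := theta2_mul_theta3_two_mul hτ u (-u)
  rw [← two_mul, sub_self] at hplus
  rw [add_neg_cancel, sub_neg_eq_add, ← two_mul, theta1_neg, theta2_neg] at hminus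
  linear_combination (hplus - hminus) / 2

theorem theta2_sq {τ : ℂ} (hτ : 0 < τ.im) (u : ℂ) :
    theta2 u τ ^ 2 = theta2 0 (2 * τ) * theta3 (2 * u) (2 * τ) +
      theta3 0 (2 * τ) * theta2 (2 * u) (2 * τ) := by
  have hplus := theta2_mul_theta3_two_mul hτ u u
  have hminus := theta2_mul_theta3_two_mul hτ u (-u)
  rw [← two_mul, sub_self] at hplus
  rw [add_neg_cancel, sub_neg_eq_add, ← two_mul, theta1_neg, theta2_neg] at hminus
  linear_combination -(hplus + hminus) / 2

theorem theta3_sq {τ : ℂ} (hτ : 0 < τ.im) (u : ℂ) :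
    theta3 u τ ^ 2 = theta3 0 (2 * τ) * theta3 (2 * u) (2 * τ) +
      theta2 0 (2 * τ) * theta2 (2 * u) (2 * τ) := by
  have h3 := theta3_mul_theta3_two_mul hτ u u
  have h2 := theta2_mul_theta2_two_mul hτ u u
  rw [← two_mul, sub_self] at h3 h2
  linear_combination -(h3 + h2) / 2

theorem theta4_sq {τ : ℂ} (hτ : 0 < τ.im) (u : ℂ) :
    theta4 u τ ^ 2 = theta3 0 (2 * τ) * theta3 (2 * u) (2 * τ) -
      theta2 0 (2 * τ) * theta2 (2 * u) (2 * τ) := by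
  have h3 := theta3_mul_theta3_two_mul hτ u u
  have h2 := theta2_mul_theta2_two_mul hτ u u
  rw [← two_mul, sub_self] at h3 h2
  linear_combination (h2 - h3) / 2

theorem theta2_zero_sq {τ : ℂ} (hτ : 0 < τ.im) :
    theta2 0 τ ^ 2 = 2 * theta2 0 (2 * τ) * theta3 0 (2 * τ) := by
  rw [theta2_sq hτ, mul_zero]
  ring

theorem theta3_zero_sq {τ : ℂ} (hτ : 0 < τ.im) :
    theta3 0 τ ^ 2 = theta3 0 (2 * τ) ^ 2 + theta2 0 (2 * τ) ^ 2 := by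
  rw [theta3_sq hτ, mul_zero]
  ring

theorem theta4_zero_sq {τ : ℂ} (hτ : 0 < τ.im) :
    theta4 0 τ ^ 2 = theta3 0 (2 * τ) ^ 2 - theta2 0 (2 * τ) ^ 2 := by
  rw [theta4_sq hτ, mul_zero]
  ring

theorem theta4_zero_two_mul_sq {τ : ℂ} (hτ : 0 < τ.im) :
    theta4 0 (2 * τ) ^ 2 = theta3 0 τ * theta4 0 τ := by
  have h := theta4_mul_theta4_two_mul hτ 0 0
  simp only [add_zero, sub_zero] at h
  linear_combination h / 2

theorem theta1_sq_add_theta2_sq {τ : ℂ} (hτ : 0 < τ.im) (u : ℂ) :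
    theta3 0 τ ^ 2 * theta1 u τ ^ 2 + theta4 0 τ ^ 2 * theta2 u τ ^ 2 =
      theta2 0 τ ^ 2 * theta4 u τ ^ 2 := by
  rw [theta2_zero_sq hτ, theta3_zero_sq hτ, theta4_zero_sq hτ, theta1_sq hτ, theta2_sq hτ,
    theta4_sq hτ]
  ring

theorem theta1_sq_add_theta3_sq {τ : ℂ} (hτ : 0 < τ.im) (u : ℂ) :
    theta2 0 τ ^ 2 * theta1 u τ ^ 2 + theta4 0 τ ^ 2 * theta3 u τ ^ 2 =
      theta3 0 τ ^ 2 * theta4 u τ ^ 2 := by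
  rw [theta2_zero_sq hτ, theta3_zero_sq hτ, theta4_zero_sq hτ, theta1_sq hτ, theta3_sq hτ,
    theta4_sq hτ]
  ring

theorem theta_zero_pow_four {τ : ℂ} (hτ : 0 < τ.im) :
    theta2 0 τ ^ 4 + theta4 0 τ ^ 4 = theta3 0 τ ^ 4 := by
  simp only [show 4 = 2 * 2 from rfl, pow_mul, theta2_zero_sq hτ, theta3_zero_sq hτ,
    theta4_zero_sq hτ]
  ring

/-! ### Behaviour at the cusp -/

theorem norm_nomePow_ofReal (τ : ℂ) (a : ℝ) : ‖nomePow τ a‖ = Real.exp (-π * a * τ.im) := by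
  rw [nomePow, Complex.norm_exp]
  simp [mul_right_comm]

theorem tendsto_nomePow_ofReal {a : ℝ} (ha : 0 < a) :
    Tendsto (fun τ => nomePow τ a) (comap im atTop) (𝓝 0) := by
  rw [tendsto_zero_iff_norm_tendsto_zero]
  simp only [norm_nomePow_ofReal]
  have hneg : -π * a < 0 := mul_neg_of_neg_of_pos (neg_neg_of_pos Real.pi_pos) ha
  exact Real.tendsto_exp_atBot.comp (tendsto_comap.const_mul_atTop_of_neg hneg)

theorem tendsto_tsum_mul_nomePow {ι : Type*} {c : ι → ℂ} {p : ι → ℕ}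
    (hs : Summable fun i => ‖c i‖ * Real.exp (-π * p i)) :
    Tendsto (fun τ => ∑' i, c i * nomePow τ (p i)) (comap im atTop)
      (𝓝 (∑' i, if p i = 0 then c i else 0)) := by
  refine tendsto_tsum_of_dominated_convergence hs (fun i => ?_) ?_
  · split_ifs with hi
    · simpa [hi, nomePow] using tendsto_const_nhds
    · simpa using (tendsto_nomePow_ofReal (a := p i) (by positivity)).const_mul (c i)
  · filter_upwards [tendsto_comap.eventually (eventually_ge_atTop 1)] with τ hτ i
    rw [norm_mul, ← ofReal_natCast, norm_nomePow_ofReal]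
    refine mul_le_mul_of_nonneg_left (Real.exp_le_exp.2 ?_) (norm_nonneg _)
    have : 0 ≤ π * p i := by positivity
    nlinarith

theorem summable_mul_exp_of_le {c : ℕ → ℂ} {p : ℕ → ℕ} (hc : ∀ n, ‖c n‖ ≤ 2 * n + 1)
    (hp : ∀ n, n ≤ p n) : Summable fun n => ‖c n‖ * Real.exp (-π * p n) := by
  have hbound : Summable fun n : ℕ => 2 * (n ^ 1 * Real.exp (-π * n)) +
      n ^ 0 * Real.exp (-π * n) :=
    ((Real.summable_pow_mul_exp_neg_nat_mul 1 Real.pi_pos).mul_left 2).add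
      (Real.summable_pow_mul_exp_neg_nat_mul 0 Real.pi_pos)
  refine hbound.of_nonneg_of_le (fun n => by positivity) fun n => ?_
  have hexp : Real.exp (-π * p n) ≤ Real.exp (-π * n) := by
    have : (n : ℝ) ≤ p n := by exact_mod_cast hp n
    exact Real.exp_le_exp.2 (mul_le_mul_of_nonpos_left this (by linarith [Real.pi_pos]))
  calc ‖c n‖ * Real.exp (-π * p n) ≤ (2 * n + 1) * Real.exp (-π * n) := by gcongr; exact hc n
    _ = _ := by ring

theorem tendsto_tsum_mul_nomePow_sq_add_self {c : ℕ → ℂ} (hc : ∀ n, ‖c n‖ ≤ 2 * n + 1) :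
    Tendsto (fun τ => ∑' n, c n * nomePow τ (n ^ 2 + n : ℕ)) (comap im atTop)
      (𝓝 (c 0)) := by
  have h := tendsto_tsum_mul_nomePow (summable_mul_exp_of_le (p := fun n => n ^ 2 + n) hc
    fun n => Nat.le_add_left n _)
  simpa [tsum_ite_eq] using h

theorem tendsto_tsum_mul_nomePow_succ_sq {c : ℕ → ℂ} (hc : ∀ n, ‖c n‖ ≤ 2 * n + 1) :
    Tendsto (fun τ => ∑' n, c n * nomePow τ ((n + 1) ^ 2 : ℕ)) (comap im atTop)
      (𝓝 0) := by
  have h := tendsto_tsum_mul_nomePow (summable_mul_exp_of_le (p := fun n => (n + 1) ^ 2) hc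
    fun n => by nlinarith)
  simpa using h

theorem nomePow_add (τ a b : ℂ) : nomePow τ (a + b) = nomePow τ a * nomePow τ b := by
  rw [nomePow, nomePow, nomePow, ← exp_add]
  ring_nf

theorem nomePow_ne_zero (τ a : ℂ) : nomePow τ a ≠ 0 :=
  exp_ne_zero _

theorem theta2_zero_eq (τ : ℂ) :
    theta2 0 τ = nomePow τ (1 / 4) * (2 * ∑' n : ℕ, 1 * nomePow τ (n ^ 2 + n : ℕ)) := by
  rw [theta2, mul_left_comm, ← tsum_mul_left (a := nomePow τ (1 / 4))]
  congr 1
  refine tsum_congr fun n => ?_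
  rw [one_mul, ← nomePow_add, mul_zero, Complex.cos_zero, mul_one]
  push_cast
  ring_nf

theorem tendsto_theta2_zero :
    Tendsto (fun τ => theta2 0 τ / nomePow τ (1 / 4)) (comap im atTop) (𝓝 2) := by
  simp only [theta2_zero_eq, mul_div_cancel_left₀ _ (nomePow_ne_zero _ _)]
  simpa using (tendsto_tsum_mul_nomePow_sq_add_self (c := fun _ => 1) (by simp)).const_mul 2

theorem tendsto_theta3_zero : Tendsto (fun τ => theta3 0 τ) (comap im atTop) (𝓝 1) := by
  have h := ((tendsto_tsum_mul_nomePow_succ_sq (c := fun _ => 1) (by simp)).const_mul 2).const_add 1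
  simpa [theta3] using h

theorem tendsto_theta4_zero : Tendsto (fun τ => theta4 0 τ) (comap im atTop) (𝓝 1) := by
  have h := (tendsto_tsum_mul_nomePow_succ_sq (c := fun n => (-1) ^ (n + 1)) (by simp)).const_mul 2
    |>.const_add 1
  simpa [theta4] using h

theorem theta1_eq_jacobiTheta₂ {τ : ℂ} (hτ : 0 < τ.im) (u : ℂ) :
    theta1 u τ = -I * (exp (π * I * τ / 4 + I * u) * jacobiTheta₂ (u / π + (τ + 1) / 2) τ) := by
  have h := exp_mul_theta4_add hτ u
  rw [theta4_eq_theta3, theta3_eq_jacobiTheta₂ hτ,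
    show (u + π * τ / 2 + π / 2) / π = u / π + (τ + 1) / 2 by field_simp; ring] at h
  linear_combination I * h + theta1 u τ * I_sq

theorem hasDerivAt_theta1_zero {τ : ℂ} (hτ : 0 < τ.im) :
    HasDerivAt (theta1 · τ) (nomePow τ (1 / 4) *
      (jacobiTheta₂ ((τ + 1) / 2) τ - I / π * jacobiTheta₂' ((τ + 1) / 2) τ)) 0 := by
  have hexp : HasDerivAt (fun u : ℂ => exp (π * I * τ / 4 + I * u))
      (exp (π * I * τ / 4 + I * 0) * (I * 1)) 0 :=
    (((hasDerivAt_id (0 : ℂ)).const_mul I).const_add _).cexp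
  have hjacobi : HasDerivAt (fun u : ℂ => jacobiTheta₂ (u / π + (τ + 1) / 2) τ)
      (jacobiTheta₂' (0 / π + (τ + 1) / 2) τ * (1 / π)) 0 :=
    (hasDerivAt_jacobiTheta₂_fst _ hτ).comp 0 (((hasDerivAt_id (0 : ℂ)).div_const _).add_const _)
  simp only [theta1_eq_jacobiTheta₂ hτ]
  convert! (hexp.mul hjacobi).const_mul (-I) using 1
  rw [nomePow, show (π : ℂ) * I * τ * (1 / 4) = π * I * τ / 4 by ring]
  simp only [zero_div, zero_add, mul_zero, add_zero]
  linear_combination exp (π * I * τ / 4) * jacobiTheta₂ ((τ + 1) / 2) τ * I_sq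

theorem jacobiTheta₂_term_add_one_div_two (n : ℤ) (τ : ℂ) :
    jacobiTheta₂_term n ((τ + 1) / 2) τ = (-1) ^ n * nomePow τ (n ^ 2 + n : ℤ) := by
  rw [add_div, jacobiTheta₂_term_add_half, jacobiTheta₂_term, nomePow]
  push_cast
  ring_nf

theorem hasSum_deriv_theta1_zero {τ : ℂ} (hτ : 0 < τ.im) :
    HasSum (fun n : ℕ => 2 * ((-1) ^ n * (2 * n + 1) * nomePow τ (n ^ 2 + n : ℕ)))
      (jacobiTheta₂ ((τ + 1) / 2) τ - I / π * jacobiTheta₂' ((τ + 1) / 2) τ) := by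
  have hsum := ((hasSum_jacobiTheta₂_term ((τ + 1) / 2) hτ).sub
    ((hasSum_jacobiTheta₂'_term ((τ + 1) / 2) hτ).mul_left (I / π))).nat_add_neg_add_one
  have hterm (n : ℤ) : jacobiTheta₂_term n ((τ + 1) / 2) τ -
      I / π * jacobiTheta₂'_term n ((τ + 1) / 2) τ =
      (-1) ^ n * (2 * n + 1) * nomePow τ (n ^ 2 + n : ℤ) := by
    rw [jacobiTheta₂'_term, jacobiTheta₂_term_add_one_div_two]
    field_simp
    linear_combination -2 * (n : ℂ) * nomePow τ (n ^ 2 + n : ℤ) * I_sq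
  refine hsum.congr_fun fun n => ?_
  rw [hterm, hterm, zpow_neg, zpow_add_one₀ (by norm_num), zpow_natCast,
    show (-(n + 1 : ℤ)) ^ 2 + -(n + 1 : ℤ) = (n : ℤ) ^ 2 + n by ring, mul_neg_one, inv_neg,
    ← inv_pow, inv_neg_one]
  push_cast
  ring

theorem tendsto_deriv_theta1_zero :
    Tendsto (fun τ => deriv (theta1 · τ) 0 / nomePow τ (1 / 4)) (comap im atTop)
      (𝓝 2) := by
  have hnorm (n : ℕ) : ‖(-1 : ℂ) ^ n * (2 * n + 1)‖ ≤ 2 * n + 1 := by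
    simpa using norm_add_le (2 * n : ℂ) 1
  have h := (tendsto_tsum_mul_nomePow_sq_add_self hnorm).const_mul 2
  simp only [pow_zero, Nat.cast_zero, mul_zero, zero_add, mul_one] at h
  refine h.congr' ?_
  filter_upwards [tendsto_comap.eventually (eventually_gt_atTop 0)] with τ hτ
  rw [(hasDerivAt_theta1_zero hτ).deriv, mul_div_cancel_left₀ _ (nomePow_ne_zero _ _),
    ← (hasSum_deriv_theta1_zero hτ).tsum_eq, tsum_mul_left]

theorem im_two_pow_mul (n : ℕ) (τ : ℂ) : (2 ^ n * τ).im = 2 ^ n * τ.im := by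
  rw [show (2 : ℂ) ^ n = ((2 ^ n : ℝ) : ℂ) by push_cast; rfl, im_ofReal_mul]

theorem im_two_pow_mul_pos {τ : ℂ} (hτ : 0 < τ.im) (n : ℕ) : 0 < (2 ^ n * τ).im := by
  rw [im_two_pow_mul]
  positivity

theorem tendsto_two_pow_mul {τ : ℂ} (hτ : 0 < τ.im) :
    Tendsto (fun n : ℕ => 2 ^ n * τ) atTop (comap im atTop) := by
  simp only [tendsto_comap_iff, Function.comp_def, im_two_pow_mul]
  exact (tendsto_pow_atTop_atTop_of_one_lt one_lt_two).atTop_mul_const hτ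

/-! ### Jacobi's derivative formula -/

theorem theta_zero_ne_zero {τ : ℂ} (hτ : 0 < τ.im) :
    theta2 0 τ ≠ 0 ∧ theta3 0 τ ≠ 0 ∧ theta4 0 τ ≠ 0 := by
  have hcusp : ∀ᶠ τ in comap im atTop,
      theta2 0 τ ≠ 0 ∧ theta3 0 τ ≠ 0 ∧ theta4 0 τ ≠ 0 := by
    filter_upwards [tendsto_theta2_zero.eventually_ne two_ne_zero,
      tendsto_theta3_zero.eventually_ne one_ne_zero,
      tendsto_theta4_zero.eventually_ne one_ne_zero] with τ h2 h3 h4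
    exact ⟨(div_ne_zero_iff.1 h2).1, h3, h4⟩
  obtain ⟨n, hn⟩ := ((tendsto_two_pow_mul hτ).eventually hcusp).exists
  induction n with
  | zero => simpa using hn
  | succ n ih =>
    refine ih ?_
    have hpos := im_two_pow_mul_pos hτ n
    rw [pow_succ', mul_assoc] at hn
    obtain ⟨hn2, hn3, hn4⟩ := hn
    have h34 : theta3 0 (2 ^ n * τ) * theta4 0 (2 ^ n * τ) ≠ 0 :=
      theta4_zero_two_mul_sq hpos ▸ pow_ne_zero 2 hn4
    have h2 : theta2 0 (2 ^ n * τ) ^ 2 ≠ 0 :=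
      theta2_zero_sq hpos ▸ mul_ne_zero (mul_ne_zero two_ne_zero hn2) hn3
    exact ⟨(pow_ne_zero_iff two_ne_zero).1 h2, left_ne_zero_of_mul h34, right_ne_zero_of_mul h34⟩

theorem theta_wronskian_two_mul {τ : ℂ} (hτ : 0 < τ.im) (u : ℂ) :
    2 * (deriv (theta1 · (2 * τ)) u * theta4 u (2 * τ) -
      theta1 u (2 * τ) * deriv (theta4 · (2 * τ)) u) = theta2 u τ * deriv (theta1 · τ) 0 := by
  have hτ2 : 0 < (2 * τ).im := by simpa using hτ
  have hderiv1 : HasDerivAt (fun y => theta1 (u + y) (2 * τ)) (deriv (theta1 · (2 * τ)) u) 0 := by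
    simpa using (differentiable_theta1 hτ2 (u + 0)).hasDerivAt.comp_const_add u 0
  have hderiv4 : HasDerivAt (fun y => theta4 (u - y) (2 * τ)) (-deriv (theta4 · (2 * τ)) u) 0 := by
    simpa using (differentiable_theta4 hτ2 (u - 0)).hasDerivAt.comp_const_sub u 0
  have hleft := (hderiv1.mul hderiv4).const_mul 2
  have hright := ((differentiable_theta2 hτ 0).hasDerivAt.const_mul (theta1 u τ)).add
    ((differentiable_theta1 hτ 0).hasDerivAt.const_mul (theta2 u τ))
  have heq := (hleft.congr_of_eventuallyEq (.of_eq (funext fun y =>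
    (theta1_mul_theta4_two_mul hτ u y).symm))).unique hright
  simp only [add_zero, sub_zero, deriv_theta2_zero, mul_zero, zero_add] at heq
  linear_combination heq

theorem deriv_theta1_zero_div_two_mul {τ : ℂ} (hτ : 0 < τ.im) :
    deriv (theta1 · (2 * τ)) 0 / (theta2 0 (2 * τ) * theta3 0 (2 * τ) * theta4 0 (2 * τ)) =
      deriv (theta1 · τ) 0 / (theta2 0 τ * theta3 0 τ * theta4 0 τ) := by
  have hτ2 : 0 < (2 * τ).im := by simpa using hτ
  obtain ⟨h2, h3, h4⟩ := theta_zero_ne_zero hτ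
  obtain ⟨h2', h3', h4'⟩ := theta_zero_ne_zero hτ2
  have hwronskian := theta_wronskian_two_mul hτ 0
  rw [theta1_zero, zero_mul, sub_zero] at hwronskian
  rw [div_eq_div_iff (by positivity) (by positivity)]
  apply mul_left_cancel₀ h4'
  linear_combination (theta2 0 τ * theta3 0 τ * theta4 0 τ / 2) * hwronskian -
    deriv (theta1 · τ) 0 * theta2 0 (2 * τ) * theta3 0 (2 * τ) * theta4_zero_two_mul_sq hτ +
    deriv (theta1 · τ) 0 * theta3 0 τ * theta4 0 τ / 2 * theta2_zero_sq hτ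

theorem tendsto_deriv_theta1_zero_div :
    Tendsto (fun τ => deriv (theta1 · τ) 0 / (theta2 0 τ * theta3 0 τ * theta4 0 τ))
      (comap im atTop) (𝓝 1) := by
  have h := tendsto_deriv_theta1_zero.div
    ((tendsto_theta2_zero.mul tendsto_theta3_zero).mul tendsto_theta4_zero) (by norm_num)
  rw [mul_one, mul_one, div_self two_ne_zero] at h
  refine h.congr fun τ => ?_
  have := nomePow_ne_zero τ (1 / 4)
  simp only [Pi.div_apply]
  field_simp

-- The quotient of both sides is invariant under `τ ↦ 2τ` and tends to `1` at the cusp.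
theorem deriv_theta1_zero {τ : ℂ} (hτ : 0 < τ.im) :
    deriv (theta1 · τ) 0 = theta2 0 τ * theta3 0 τ * theta4 0 τ := by
  have hpow (n : ℕ) : deriv (theta1 · (2 ^ n * τ)) 0 /
      (theta2 0 (2 ^ n * τ) * theta3 0 (2 ^ n * τ) * theta4 0 (2 ^ n * τ)) =
      deriv (theta1 · τ) 0 / (theta2 0 τ * theta3 0 τ * theta4 0 τ) := by
    induction n with
    | zero => simp
    | succ n ih =>
      rw [pow_succ', mul_assoc, deriv_theta1_zero_div_two_mul (im_two_pow_mul_pos hτ n), ih]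
  have hone := tendsto_deriv_theta1_zero_div.comp (tendsto_two_pow_mul hτ)
  simp only [Function.comp_def, hpow] at hone
  obtain ⟨h2, h3, h4⟩ := theta_zero_ne_zero hτ
  rw [← div_eq_one_iff_eq (by positivity)]
  exact tendsto_nhds_unique tendsto_const_nhds hone

theorem theta_wronskian {τ : ℂ} (hτ : 0 < τ.im) (u : ℂ) :
    deriv (theta1 · τ) u * theta4 u τ - theta1 u τ * deriv (theta4 · τ) u =
      theta4 0 τ ^ 2 * (theta2 u τ * theta3 u τ) := by
  obtain ⟨σ, rfl⟩ : ∃ σ, τ = 2 * σ := ⟨τ / 2, (mul_div_cancel₀ _ two_ne_zero).symm⟩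
  have hσ : 0 < σ.im := by simpa using hτ
  have hwronskian := theta_wronskian_two_mul hσ u
  have hdouble := theta2_mul_theta3_two_mul hσ u 0
  rw [deriv_theta1_zero hσ] at hwronskian
  rw [add_zero, sub_zero, theta1_zero, mul_zero, sub_zero] at hdouble
  linear_combination hwronskian / 2 - theta2 u (2 * σ) * theta3 u (2 * σ) *
    theta4_zero_two_mul_sq hσ - theta3 0 σ * theta4 0 σ / 2 * hdouble

/-! ### Meromorphic functions up to discrete sets -/

section Codiscrete

variable {X Y : Type*} [TopologicalSpace X] [TopologicalSpace Y]

theorem eventually_codiscrete_iff {p : X → Prop} :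
    (∀ᶠ x in codiscrete X, p x) ↔ ∀ x, ∀ᶠ y in 𝓝[≠] x, p y := by
  simp [codiscrete, Filter.Eventually, mem_codiscreteWithin_iff_forall_mem_nhdsNE]

theorem eventually_eventually_nhds_of_codiscrete {p : X → Prop} (h : ∀ᶠ x in codiscrete X, p x) :
    ∀ᶠ x in codiscrete X, ∀ᶠ y in 𝓝 x, p y :=
  h.mono fun _ hx => (mem_codiscrete'.1 h).1.mem_nhds hx

theorem tendsto_nhdsNE_of_injective {f : X → Y} {x : X} (hf : ContinuousAt f x)
    (hinj : Function.Injective f) : Tendsto f (𝓝[≠] x) (𝓝[≠] (f x)) :=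
  tendsto_nhdsWithin_iff.2 ⟨hf.tendsto.mono_left nhdsWithin_le_nhds,
    eventually_mem_nhdsWithin.mono fun _ hy => hinj.ne hy⟩

theorem tendsto_codiscrete_of_injective {f : X → Y} (hf : Continuous f)
    (hinj : Function.Injective f) : Tendsto f (codiscrete X) (codiscrete Y) := fun _ hs =>
  eventually_codiscrete_iff.2 fun x =>
    (tendsto_nhdsNE_of_injective hf.continuousAt hinj).eventually
      (eventually_codiscrete_iff.1 hs (f x))

end Codiscrete

section Meromorphic

variable {𝕜 E : Type*} [NontriviallyNormedField 𝕜] [NormedAddCommGroup E] [NormedSpace 𝕜 E]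

theorem eventuallyEq_zero_or_eventually_ne_zero [ConnectedSpace 𝕜] [CompleteSpace E] {f : 𝕜 → E}
    (hf : Meromorphic f) :
    f =ᶠ[codiscrete 𝕜] 0 ∨ ∀ᶠ z in codiscrete 𝕜, f z ≠ 0 := by
  by_cases hfinite : ∃ x ∈ Set.univ, meromorphicOrderAt f x ≠ ⊤
  · exact .inr (hf.meromorphicOn.eventually_codiscreteWithin_apply_ne_zero
      ((hf.meromorphicOn.exists_meromorphicOrderAt_ne_top_iff_forall_mem isConnected_univ).1
        hfinite))
  · push Not at hfinite
    exact .inl (eventually_codiscrete_iff.2 fun x =>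
      meromorphicOrderAt_eq_top_iff.1 (hfinite x trivial))

theorem eventuallyEq_codiscrete_of_eventuallyEq_nhdsNE [ConnectedSpace 𝕜] [CompleteSpace E]
    {f g : 𝕜 → E} (hf : Meromorphic f) (hg : Meromorphic g) {x : 𝕜} (h : f =ᶠ[𝓝[≠] x] g) :
    f =ᶠ[codiscrete 𝕜] g := by
  rcases eventuallyEq_zero_or_eventually_ne_zero (hf.sub hg) with hzero | hne
  · exact hzero.mono fun z hz => sub_eq_zero.1 hz
  · obtain ⟨z, hz, hz'⟩ := (h.and (eventually_codiscrete_iff.1 hne x)).exists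
    exact absurd (sub_eq_zero.2 hz) hz'

theorem eventually_ne_zero_of_tendsto [ConnectedSpace 𝕜] [CompleteSpace E] {f : 𝕜 → E}
    (hf : Meromorphic f) {x : 𝕜} {a : E} (ha : a ≠ 0) (h : Tendsto f (𝓝[≠] x) (𝓝 a)) :
    ∀ᶠ z in codiscrete 𝕜, f z ≠ 0 := by
  refine (eventuallyEq_zero_or_eventually_ne_zero hf).resolve_left fun hzero => ?_
  obtain ⟨z, hz, hz'⟩ := ((h.eventually_ne ha).and (eventually_codiscrete_iff.1 hzero x)).exists
  exact hz hz'

theorem eq_of_eventuallyEq_codiscrete {f g : 𝕜 → E} (hf : MeromorphicNFOn f Set.univ)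
    (hg : MeromorphicNFOn g Set.univ) (h : f =ᶠ[codiscrete 𝕜] g) : f = g := by
  funext x
  exact (((hf (Set.mem_univ x)).eventuallyEq_nhdsNE_iff_eventuallyEq_nhds
    (hg (Set.mem_univ x))).1 (eventually_codiscrete_iff.1 h x)).eq_of_nhds

theorem meromorphicNFOn_comp_const_mul {f : 𝕜 → E} (hf : MeromorphicNFOn f Set.univ) (a : 𝕜) :
    MeromorphicNFOn (fun z => f (a * z)) Set.univ := fun x _ =>
  (hf (Set.mem_univ (a * x))).comp_analyticAt (g := fun z => a * z) (by fun_prop)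

theorem meromorphicNFOn_const_mul {f : 𝕜 → 𝕜} (hf : MeromorphicNFOn f Set.univ) {a : 𝕜}
    (ha : a ≠ 0) : MeromorphicNFOn (fun z => a * f z) Set.univ := fun x _ =>
  (meromorphicNFAt_mul_iff_right (g := fun _ => a) analyticAt_const ha).2 (hf (Set.mem_univ x))

theorem analyticAt_and_eq_of_tendsto {f : 𝕜 → E} {x : 𝕜} {a : E}
    (hf : MeromorphicNFAt f x) (h : Tendsto f (𝓝[≠] x) (𝓝 a)) : AnalyticAt 𝕜 f x ∧ f x = a := by
  have hanalytic : AnalyticAt 𝕜 f x := hf.meromorphicOrderAt_nonneg_iff_analyticAt.1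
    ((tendsto_nhds_iff_meromorphicOrderAt_nonneg hf.meromorphicAt).1 ⟨a, h⟩)
  exact ⟨hanalytic, tendsto_nhds_unique
    (hanalytic.continuousAt.tendsto.mono_left nhdsWithin_le_nhds) h⟩

theorem eventually_hasDerivAt_congr {f f' g g' : 𝕜 → E}
    (h : ∀ᶠ z in codiscrete 𝕜, HasDerivAt f (f' z) z) (hf : g =ᶠ[codiscrete 𝕜] f)
    (hf' : g' =ᶠ[codiscrete 𝕜] f') : ∀ᶠ z in codiscrete 𝕜, HasDerivAt g (g' z) z := by
  filter_upwards [h, eventually_eventually_nhds_of_codiscrete hf, hf'] with z hderiv hz hz'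
  exact hz' ▸ hderiv.congr_of_eventuallyEq hz

theorem eventually_hasDerivAt_nhds [CompleteSpace E] {f f' : 𝕜 → E} {x : 𝕜}
    (hf : AnalyticAt 𝕜 f x) (hf' : AnalyticAt 𝕜 f' x)
    (h : ∀ᶠ z in 𝓝[≠] x, HasDerivAt f (f' z) z) : ∀ᶠ z in 𝓝 x, HasDerivAt f (f' z) z := by
  have hfrequently : ∃ᶠ z in 𝓝[≠] x, deriv f z = f' z := (h.mono fun _ hz => hz.deriv).frequently
  filter_upwards [(hf.deriv.frequently_eq_iff_eventually_eq hf').1 hfrequently,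
    hf.eventually_analyticAt] with z hz hanalytic
  exact hz ▸ hanalytic.differentiableAt.hasDerivAt

end Meromorphic

theorem eq_of_eventually_ofReal {E : Type*} [NormedAddCommGroup E] [NormedSpace ℂ E]
    [CompleteSpace E] {f g : ℂ → E} (hf : MeromorphicNFOn f Set.univ)
    (hg : MeromorphicNFOn g Set.univ) {x : ℝ} (h : ∀ᶠ t : ℝ in 𝓝 x, f t = g t) : f = g := by
  have hreal : Tendsto (fun t : ℝ => (t : ℂ)) (𝓝[≠] x) (𝓝[≠] (x : ℂ)) :=
    tendsto_nhdsNE_of_injective Complex.continuous_ofReal.continuousAt Complex.ofReal_injective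
  have hmero {f : ℂ → E} (hf : MeromorphicNFOn f Set.univ) : Meromorphic f :=
    meromorphicOn_univ.1 hf.meromorphicOn
  exact eq_of_eventuallyEq_codiscrete hf hg <|
    eventuallyEq_codiscrete_of_eventuallyEq_nhdsNE (hmero hf) (hmero hg) <|
      ((hmero hf x).frequently_eq_iff_eventuallyEq (hmero hg x)).1 <|
        hreal.frequently (h.filter_mono nhdsWithin_le_nhds).frequently

theorem eventuallyEq_of_hasDerivAt_of_contDiffAt {E : Type*} [NormedAddCommGroup E]
    [NormedSpace ℝ E] {v : E → E} {f g : ℝ → E} {x : ℝ} (hv : ContDiffAt ℝ 1 v (f x))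
    (hf : ∀ᶠ t in 𝓝 x, HasDerivAt f (v (f t)) t) (hg : ∀ᶠ t in 𝓝 x, HasDerivAt g (v (g t)) t)
    (h : f x = g x) : f =ᶠ[𝓝 x] g := by
  obtain ⟨K, U, hU, hK⟩ := hv.exists_lipschitzOnWith
  have hfU := hf.self_of_nhds.continuousAt.eventually_mem hU
  have hgU := hg.self_of_nhds.continuousAt.eventually_mem (h ▸ hU)
  exact ODE_solution_unique_of_eventually (.of_forall fun _ => hK) (hf.and hfU) (hg.and hgU) h

theorem meromorphicNFOn_regularize (f : ℂ → ℂ) : MeromorphicNFOn (regularize f) Set.univ :=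
  meromorphicNFOn_toMeromorphicNFOn _ _

theorem meromorphic_regularize (f : ℂ → ℂ) : Meromorphic (regularize f) :=
  meromorphicOn_univ.1 (meromorphicNFOn_regularize f).meromorphicOn

theorem regularize_eventuallyEq {f : ℂ → ℂ} (hf : Meromorphic f) :
    regularize f =ᶠ[codiscrete ℂ] f :=
  (toMeromorphicNFOn_eqOn_codiscrete hf.meromorphicOn).symm

theorem regularize_eq_self {f : ℂ → ℂ} (hf : MeromorphicNFOn f Set.univ) : regularize f = f :=
  toMeromorphicNFOn_eq_self.2 hf

theorem regularize_inv {f : ℂ → ℂ} (hf : Meromorphic f) :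
    regularize (fun z => (f z)⁻¹) = fun z => (regularize f z)⁻¹ :=
  eq_of_eventuallyEq_codiscrete (meromorphicNFOn_regularize _)
    (meromorphicNFOn_fun_inv.2 (meromorphicNFOn_regularize f))
    ((regularize_eventuallyEq hf.fun_inv).trans (regularize_eventuallyEq hf).symm.inv)

theorem tendsto_regularize {f : ℂ → ℂ} (hf : Meromorphic f) {x : ℂ} {l : Filter ℂ}
    (h : Tendsto f (𝓝[≠] x) l) : Tendsto (regularize f) (𝓝[≠] x) l :=
  h.congr' (eventually_codiscrete_iff.1 (regularize_eventuallyEq hf).symm x)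

/-! ### Jacobi systems -/

/-- The system `s' = c d`, `c² + α s² = 1`, `d² + β s² = 1` with initial values `0, 1, 1` for
meromorphic functions on `ℂ`. The Jacobi functions `sn, cn, dn` of modulus `k` are the case
`α = 1`, `β = k²`; their quotients by `cn` or `dn` satisfy systems with other parameters. The
functions are normalized at every point (see `regularize`), so that the system determines them. -/
structure JacobiTriple (α β : ℂ) (s c d : ℂ → ℂ) : Prop where
  normalForm_s : MeromorphicNFOn s Set.univ
  normalForm_c : MeromorphicNFOn c Set.univ
  normalForm_d : MeromorphicNFOn d Set.univ
  tendsto_s : Tendsto s (𝓝[≠] 0) (𝓝 0)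
  tendsto_c : Tendsto c (𝓝[≠] 0) (𝓝 1)
  tendsto_d : Tendsto d (𝓝[≠] 0) (𝓝 1)
  deriv_s : ∀ᶠ z in codiscrete ℂ, HasDerivAt s (c z * d z) z
  sq_c : ∀ᶠ z in codiscrete ℂ, c z ^ 2 + α * s z ^ 2 = 1
  sq_d : ∀ᶠ z in codiscrete ℂ, d z ^ 2 + β * s z ^ 2 = 1

theorem hasDerivAt_of_sq_add_mul_sq {f s : ℂ → ℂ} {b s' z : ℂ} (hf : DifferentiableAt ℂ f z)
    (hs : HasDerivAt s s' z) (h : ∀ᶠ w in 𝓝 z, f w ^ 2 + b * s w ^ 2 = 1) (h0 : f z ≠ 0) :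
    HasDerivAt f (-(b * s z * s' / f z)) z := by
  have hsum := (hf.hasDerivAt.pow 2).add ((hs.pow 2).const_mul b)
  have hconst : HasDerivAt (fun w => f w ^ 2 + b * s w ^ 2) 0 z :=
    (hasDerivAt_const z (1 : ℂ)).congr_of_eventuallyEq h
  have hzero := hsum.unique hconst
  convert! hf.hasDerivAt using 1
  field_simp
  norm_num at hzero
  linear_combination -hzero / 2

namespace JacobiTriple

variable {α β : ℂ} {s c d : ℂ → ℂ}

theorem of_meromorphic (hs : Meromorphic s) (hc : Meromorphic c) (hd : Meromorphic d)
    (hs0 : Tendsto s (𝓝[≠] 0) (𝓝 0)) (hc0 : Tendsto c (𝓝[≠] 0) (𝓝 1))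
    (hd0 : Tendsto d (𝓝[≠] 0) (𝓝 1))
    (hderiv : ∀ᶠ z in codiscrete ℂ, HasDerivAt s (c z * d z) z)
    (hsq_c : ∀ᶠ z in codiscrete ℂ, c z ^ 2 + α * s z ^ 2 = 1)
    (hsq_d : ∀ᶠ z in codiscrete ℂ, d z ^ 2 + β * s z ^ 2 = 1) :
    JacobiTriple α β (regularize s) (regularize c) (regularize d) where
  normalForm_s := meromorphicNFOn_regularize s
  normalForm_c := meromorphicNFOn_regularize c
  normalForm_d := meromorphicNFOn_regularize d
  tendsto_s := tendsto_regularize hs hs0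
  tendsto_c := tendsto_regularize hc hc0
  tendsto_d := tendsto_regularize hd hd0
  deriv_s := eventually_hasDerivAt_congr hderiv (regularize_eventuallyEq hs)
    ((regularize_eventuallyEq hc).mul (regularize_eventuallyEq hd))
  sq_c := by
    filter_upwards [regularize_eventuallyEq hs, regularize_eventuallyEq hc, hsq_c] with z es ec h
    rwa [es, ec]
  sq_d := by
    filter_upwards [regularize_eventuallyEq hs, regularize_eventuallyEq hd, hsq_d] with z es ed h
    rwa [es, ed]

theorem swap (h : JacobiTriple α β s c d) : JacobiTriple β α s d c where
  normalForm_s := h.normalForm_s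
  normalForm_c := h.normalForm_d
  normalForm_d := h.normalForm_c
  tendsto_s := h.tendsto_s
  tendsto_c := h.tendsto_d
  tendsto_d := h.tendsto_c
  deriv_s := by simpa only [mul_comm] using h.deriv_s
  sq_c := h.sq_d
  sq_d := h.sq_c

theorem meromorphic_s (h : JacobiTriple α β s c d) : Meromorphic s :=
  meromorphicOn_univ.1 h.normalForm_s.meromorphicOn

theorem meromorphic_c (h : JacobiTriple α β s c d) : Meromorphic c :=
  meromorphicOn_univ.1 h.normalForm_c.meromorphicOn

theorem meromorphic_d (h : JacobiTriple α β s c d) : Meromorphic d :=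
  h.swap.meromorphic_c

theorem c_ne_zero (h : JacobiTriple α β s c d) : ∀ᶠ z in codiscrete ℂ, c z ≠ 0 :=
  eventually_ne_zero_of_tendsto h.meromorphic_c one_ne_zero h.tendsto_c

theorem d_ne_zero (h : JacobiTriple α β s c d) : ∀ᶠ z in codiscrete ℂ, d z ≠ 0 :=
  h.swap.c_ne_zero

theorem s_ne_zero (h : JacobiTriple α β s c d) : ∀ᶠ z in codiscrete ℂ, s z ≠ 0 := by
  refine (eventuallyEq_zero_or_eventually_ne_zero h.meromorphic_s).resolve_left fun hzero => ?_
  have hall := eventually_codiscrete_iff.1 ((eventually_eventually_nhds_of_codiscrete hzero).and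
    (h.deriv_s.and (h.c_ne_zero.and h.d_ne_zero))) 0
  obtain ⟨z, hz, hderiv, hc, hd⟩ := hall.exists
  exact mul_ne_zero hc hd
    (hderiv.unique ((hasDerivAt_const z (0 : ℂ)).congr_of_eventuallyEq hz))

theorem deriv_c (h : JacobiTriple α β s c d) :
    ∀ᶠ z in codiscrete ℂ, HasDerivAt c (-(α * s z * d z)) z := by
  have hanalytic := MeromorphicOn.eventually_codiscreteWithin_analyticAt c
    (h.meromorphic_c.meromorphicOn (s := Set.univ))
  filter_upwards [hanalytic, h.deriv_s, eventually_eventually_nhds_of_codiscrete h.sq_c,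
    h.c_ne_zero] with z hc hs hsq hne
  convert! hasDerivAt_of_sq_add_mul_sq hc.differentiableAt hs hsq hne using 1
  field_simp

theorem deriv_d (h : JacobiTriple α β s c d) :
    ∀ᶠ z in codiscrete ℂ, HasDerivAt d (-(β * s z * c z)) z :=
  h.swap.deriv_c

theorem div_c (h : JacobiTriple α β s c d) :
    JacobiTriple (-α) (β - α) (regularize fun z => s z / c z) (regularize fun z => 1 / c z)
      (regularize fun z => d z / c z) := by
  have hone : Meromorphic fun _ : ℂ => (1 : ℂ) := .const 1
  refine of_meromorphic (h.meromorphic_s.fun_div h.meromorphic_c) (hone.fun_div h.meromorphic_c)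
    (h.meromorphic_d.fun_div h.meromorphic_c) ?_ ?_ ?_ ?_ ?_ ?_
  · simpa only [zero_div, Pi.div_def] using h.tendsto_s.div h.tendsto_c one_ne_zero
  · simpa using h.tendsto_c.inv₀ one_ne_zero
  · simpa only [div_one, Pi.div_def] using h.tendsto_d.div h.tendsto_c one_ne_zero
  · filter_upwards [h.deriv_s, h.deriv_c, h.c_ne_zero, h.sq_c] with z hs hc hne hsq
    convert! hs.div hc hne using 1
    field_simp
    linear_combination -d z * hsq
  · filter_upwards [h.c_ne_zero, h.sq_c] with z hne hsq
    field_simp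
    linear_combination -hsq
  · filter_upwards [h.c_ne_zero, h.sq_c, h.sq_d] with z hne hsq hsq'
    field_simp
    linear_combination hsq' - hsq

theorem rescale (h : JacobiTriple α β s c d) {a : ℂ} (ha : a ≠ 0) :
    JacobiTriple (a ^ 2 * α) (a ^ 2 * β) (fun z => a⁻¹ * s (a * z)) (fun z => c (a * z))
      (fun z => d (a * z)) := by
  have hcodiscrete : Tendsto (fun z => a * z) (codiscrete ℂ) (codiscrete ℂ) :=
    tendsto_codiscrete_of_injective (continuous_const_mul a) (mul_right_injective₀ ha)
  have hzero : Tendsto (fun z => a * z) (𝓝[≠] 0) (𝓝[≠] 0) := by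
    simpa using tendsto_nhdsNE_of_injective (continuous_const_mul a).continuousAt
      (mul_right_injective₀ ha) (x := 0)
  refine ⟨meromorphicNFOn_const_mul (meromorphicNFOn_comp_const_mul h.normalForm_s a)
      (inv_ne_zero ha), meromorphicNFOn_comp_const_mul h.normalForm_c a,
    meromorphicNFOn_comp_const_mul h.normalForm_d a, ?_, h.tendsto_c.comp hzero,
    h.tendsto_d.comp hzero, ?_, ?_, ?_⟩
  · simpa using (h.tendsto_s.comp hzero).const_mul a⁻¹
  · filter_upwards [hcodiscrete.eventually h.deriv_s] with z hs
    convert! (hs.comp z ((hasDerivAt_id z).const_mul a)).const_mul a⁻¹ using 1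
    field_simp
  · filter_upwards [hcodiscrete.eventually h.sq_c] with z hsq
    field_simp
    linear_combination hsq
  · filter_upwards [hcodiscrete.eventually h.sq_d] with z hsq
    field_simp
    linear_combination hsq

theorem analyticAt_s (h : JacobiTriple α β s c d) : AnalyticAt ℂ s 0 ∧ s 0 = 0 :=
  analyticAt_and_eq_of_tendsto (h.normalForm_s trivial) h.tendsto_s

theorem analyticAt_c (h : JacobiTriple α β s c d) : AnalyticAt ℂ c 0 ∧ c 0 = 1 :=
  analyticAt_and_eq_of_tendsto (h.normalForm_c trivial) h.tendsto_c

theorem analyticAt_d (h : JacobiTriple α β s c d) : AnalyticAt ℂ d 0 ∧ d 0 = 1 :=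
  h.swap.analyticAt_c

end JacobiTriple

/-- The vector field on `ℂ³` of which `x ↦ (s x, c x, d x)`, `x` real, is an integral curve for
every `JacobiTriple α β s c d`. -/
def jacobiField (α β : ℂ) (p : ℂ × ℂ × ℂ) : ℂ × ℂ × ℂ :=
  (p.2.1 * p.2.2, -(α * p.1 * p.2.2), -(β * p.1 * p.2.1))

namespace JacobiTriple

variable {α β α' β' : ℂ} {s c d s' c' d' : ℂ → ℂ}

theorem eventually_hasDerivAt_jacobiField (h : JacobiTriple α β s c d) :
    ∀ᶠ x : ℝ in 𝓝 0, HasDerivAt (fun x : ℝ => (s x, c x, d x))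
      (jacobiField α β (s x, c x, d x)) x := by
  have hs := h.analyticAt_s.1
  have hc := h.analyticAt_c.1
  have hd := h.analyticAt_d.1
  have hreal : Tendsto (fun x : ℝ => (x : ℂ)) (𝓝 0) (𝓝 0) := Complex.continuous_ofReal.tendsto 0
  filter_upwards [
    hreal.eventually (eventually_hasDerivAt_nhds hs (hc.mul hd)
      (eventually_codiscrete_iff.1 h.deriv_s 0)),
    hreal.eventually (eventually_hasDerivAt_nhds hc ((analyticAt_const.mul hs).mul hd).neg
      (eventually_codiscrete_iff.1 h.deriv_c 0)),
    hreal.eventually (eventually_hasDerivAt_nhds hd ((analyticAt_const.mul hs).mul hc).neg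
      (eventually_codiscrete_iff.1 h.deriv_d 0))] with x hs' hc' hd'
  exact hs'.comp_ofReal.prodMk (hc'.comp_ofReal.prodMk hd'.comp_ofReal)

theorem unique (h : JacobiTriple α β s c d) (h' : JacobiTriple α' β' s' c' d') (hα : α = α')
    (hβ : β = β') : s = s' ∧ c = c' ∧ d = d' := by
  subst hα hβ
  have hfield : ContDiff ℝ 1 (jacobiField α β) := by
    unfold jacobiField
    fun_prop
  have hinit : (s (0 : ℝ), c (0 : ℝ), d (0 : ℝ)) = (s' (0 : ℝ), c' (0 : ℝ), d' (0 : ℝ)) := by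
    simp only [Complex.ofReal_zero, h.analyticAt_s.2, h.analyticAt_c.2, h.analyticAt_d.2,
      h'.analyticAt_s.2, h'.analyticAt_c.2, h'.analyticAt_d.2]
  have hcurve := eventuallyEq_of_hasDerivAt_of_contDiffAt hfield.contDiffAt
    h.eventually_hasDerivAt_jacobiField h'.eventually_hasDerivAt_jacobiField hinit
  exact ⟨eq_of_eventually_ofReal h.normalForm_s h'.normalForm_s
      (hcurve.mono fun _ hx => congrArg (·.1) hx),
    eq_of_eventually_ofReal h.normalForm_c h'.normalForm_c
      (hcurve.mono fun _ hx => congrArg (·.2.1) hx),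
    eq_of_eventually_ofReal h.normalForm_d h'.normalForm_d
      (hcurve.mono fun _ hx => congrArg (·.2.2) hx)⟩

end JacobiTriple

/-! ### The Jacobi functions -/

theorem eventually_theta4_ne_zero {τ : ℂ} (hτ : 0 < τ.im) :
    ∀ᶠ u in codiscrete ℂ, theta4 u τ ≠ 0 :=
  AnalyticOnNhd.preimage_zero_mem_codiscrete
    (fun u _ => (differentiable_theta4 hτ).analyticAt u) (theta_zero_ne_zero hτ).2.2

theorem meromorphic_const_mul_div_theta4 {τ : ℂ} (hτ : 0 < τ.im) {f : ℂ → ℂ}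
    (hf : Differentiable ℂ f) (a b : ℂ) :
    Meromorphic fun z => a * (f (z / b) / theta4 (z / b) τ) := by
  have hmero {g : ℂ → ℂ} (hg : Differentiable ℂ g) : Meromorphic fun z => g (z / b) := fun x =>
    ((hg.comp (differentiable_id.div_const b)).analyticAt x).meromorphicAt
  exact (Meromorphic.const a).fun_mul ((hmero hf).fun_div (hmero (differentiable_theta4 hτ)))

theorem tendsto_const_mul_div_theta4 {τ : ℂ} (hτ : 0 < τ.im) {f : ℂ → ℂ} (hf : Continuous f)
    (a b : ℂ) : Tendsto (fun z => a * (f (z / b) / theta4 (z / b) τ)) (𝓝[≠] 0)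
      (𝓝 (a * (f 0 / theta4 0 τ))) := by
  have hlim {g : ℂ → ℂ} (hg : Continuous g) : Tendsto (fun z => g (z / b)) (𝓝 0) (𝓝 (g 0)) := by
    simpa only [Function.comp_def, id, zero_div] using
      (hg.comp (continuous_id.div_const b)).tendsto 0
  exact (((hlim hf).div (hlim (differentiable_theta4 hτ).continuous)
    (theta_zero_ne_zero hτ).2.2).const_mul a).mono_left nhdsWithin_le_nhds

theorem hasDerivAt_theta1_div_theta4 {τ u : ℂ} (hτ : 0 < τ.im) (hu : theta4 u τ ≠ 0) :
    HasDerivAt (fun u => theta1 u τ / theta4 u τ)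
      (theta4 0 τ ^ 2 * (theta2 u τ / theta4 u τ) * (theta3 u τ / theta4 u τ)) u := by
  convert! (differentiable_theta1 hτ u).hasDerivAt.div (differentiable_theta4 hτ u).hasDerivAt hu
    using 1
  rw [theta_wronskian hτ]
  field_simp

theorem jacobiTriple_tau {τ : ℂ} (hτ : 0 < τ.im) :
    JacobiTriple 1 (modulus τ ^ 2) (snTau τ) (cnTau τ) (dnTau τ) := by
  obtain ⟨h2, h3, h4⟩ := theta_zero_ne_zero hτ
  have hne : ∀ᶠ z in codiscrete ℂ, theta4 (z / theta3 0 τ ^ 2) τ ≠ 0 :=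
    (tendsto_codiscrete_of_injective (continuous_id.div_const _)
      fun z w h => (div_left_inj' (pow_ne_zero 2 h3)).1 h).eventually (eventually_theta4_ne_zero hτ)
  refine .of_meromorphic
    (meromorphic_const_mul_div_theta4 hτ (differentiable_theta1 hτ) _ _)
    (meromorphic_const_mul_div_theta4 hτ (differentiable_theta2 hτ) _ _)
    (meromorphic_const_mul_div_theta4 hτ (differentiable_theta3 hτ) _ _) ?_ ?_ ?_ ?_ ?_ ?_
  · simpa only [theta1_zero, zero_div, mul_zero] using
      tendsto_const_mul_div_theta4 hτ (differentiable_theta1 hτ).continuous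
        (theta3 0 τ / theta2 0 τ) (theta3 0 τ ^ 2)
  · convert! tendsto_const_mul_div_theta4 hτ (differentiable_theta2 hτ).continuous _ _ using 2
    field_simp
  · convert! tendsto_const_mul_div_theta4 hτ (differentiable_theta3 hτ).continuous _ _ using 2
    field_simp
  · filter_upwards [hne] with z hz
    convert! ((hasDerivAt_theta1_div_theta4 hτ hz).comp z
      ((hasDerivAt_id z).div_const _)).const_mul (theta3 0 τ / theta2 0 τ) using 1
    field_simp
  · filter_upwards [hne] with z hz
    have hsq := theta1_sq_add_theta2_sq hτ (z / theta3 0 τ ^ 2)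
    generalize z / theta3 0 τ ^ 2 = u at *
    field_simp
    linear_combination hsq
  · filter_upwards [hne] with z hz
    have hsq := theta1_sq_add_theta3_sq hτ (z / theta3 0 τ ^ 2)
    rw [modulus]
    generalize z / theta3 0 τ ^ 2 = u at *
    field_simp
    linear_combination hsq

theorem tauOf_spec {τ : ℂ} (hτ : 0 < τ.im) :
    0 < (tauOf (modulus τ)).im ∧ modulus (tauOf (modulus τ)) = modulus τ :=
  Classical.epsilon_spec (p := fun σ : ℂ => 0 < σ.im ∧ modulus σ = modulus τ) ⟨τ, hτ, rfl⟩

theorem jacobiTriple_modulus {τ : ℂ} (hτ : 0 < τ.im) :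
    JacobiTriple 1 (modulus τ ^ 2) (sn (modulus τ)) (cn (modulus τ)) (dn (modulus τ)) := by
  obtain ⟨him, hmodulus⟩ := tauOf_spec hτ
  simpa only [hmodulus] using! jacobiTriple_tau him

/-! ### The modular group acting on the moduli -/

theorem modulus_sq_add_comodulus_sq {τ : ℂ} (hτ : 0 < τ.im) :
    modulus τ ^ 2 + comodulus τ ^ 2 = 1 := by
  have h3 := (theta_zero_ne_zero hτ).2.1
  rw [modulus, comodulus]
  field_simp
  linear_combination theta_zero_pow_four hτ

theorem modulus_ne_zero {τ : ℂ} (hτ : 0 < τ.im) : modulus τ ≠ 0 := by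
  obtain ⟨h2, h3, -⟩ := theta_zero_ne_zero hτ
  exact div_ne_zero (pow_ne_zero 2 h2) (pow_ne_zero 2 h3)

theorem comodulus_ne_zero {τ : ℂ} (hτ : 0 < τ.im) : comodulus τ ≠ 0 := by
  obtain ⟨-, h3, h4⟩ := theta_zero_ne_zero hτ
  exact div_ne_zero (pow_ne_zero 2 h4) (pow_ne_zero 2 h3)

theorem nomePow_add_one (τ a : ℂ) : nomePow (τ + 1) a = exp (π * I * a) * nomePow τ a := by
  rw [nomePow, nomePow, ← exp_add]
  congr 1
  ring

theorem exp_pi_mul_I_mul_add_one_sq (n : ℕ) :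
    exp (π * I * ((n : ℂ) + 1) ^ 2) = (-1) ^ (n + 1) := by
  rw [show (π : ℂ) * I * ((n : ℂ) + 1) ^ 2 = ((n + 1) ^ 2 : ℕ) * (π * I) by push_cast; ring,
    exp_nat_mul, exp_pi_mul_I]
  exact neg_one_pow_congr (Nat.even_pow.trans (and_iff_left two_ne_zero))

theorem exp_pi_mul_I_mul_add_half_sq (n : ℕ) :
    exp (π * I * ((n : ℂ) + 1 / 2) ^ 2) = exp (π * I / 4) := by
  rw [show (π : ℂ) * I * ((n : ℂ) + 1 / 2) ^ 2 = (n * (n + 1) : ℕ) * (π * I) + π * I / 4 by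
      push_cast; ring, exp_add, exp_nat_mul, exp_pi_mul_I,
    (Nat.even_mul_succ_self n).neg_one_pow, one_mul]

theorem theta2_add_one (u τ : ℂ) : theta2 u (τ + 1) = exp (π * I / 4) * theta2 u τ := by
  simp only [theta2, nomePow_add_one, exp_pi_mul_I_mul_add_half_sq]
  simp only [mul_assoc, tsum_mul_left]
  ring

theorem theta3_add_one (u τ : ℂ) : theta3 u (τ + 1) = theta4 u τ := by
  simp only [theta3, theta4, nomePow_add_one, exp_pi_mul_I_mul_add_one_sq]

theorem theta4_add_one (u τ : ℂ) : theta4 u (τ + 1) = theta3 u τ := by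
  simp only [theta3, theta4, nomePow_add_one, exp_pi_mul_I_mul_add_one_sq, ← mul_assoc,
    ← pow_add, Even.neg_one_pow ⟨_, rfl⟩, one_mul]

theorem modulus_add_one {τ : ℂ} (hτ : 0 < τ.im) :
    modulus (τ + 1) = I * modulus τ / comodulus τ := by
  obtain ⟨-, h3, h4⟩ := theta_zero_ne_zero hτ
  have hI : exp (π * I / 4) ^ 2 = I := by
    rw [← exp_nat_mul, show ((2 : ℕ) : ℂ) * (π * I / 4) = π / 2 * I by push_cast; ring,
      exp_pi_div_two_mul_I]
  simp only [modulus, comodulus, theta2_add_one, theta3_add_one, mul_pow, hI]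
  field_simp

theorem comodulus_add_one (τ : ℂ) : comodulus (τ + 1) = 1 / comodulus τ := by
  simp only [comodulus, theta3_add_one, theta4_add_one, one_div_div]

theorem im_neg_one_div_pos {τ : ℂ} (hτ : 0 < τ.im) : 0 < (-1 / τ).im := by
  simpa only [neg_div, one_div, inv_neg] using UpperHalfPlane.im_inv_neg_coe_pos ⟨τ, hτ⟩

theorem theta3_zero_neg_one_div {τ : ℂ} (hτ : 0 < τ.im) :
    theta3 0 τ = 1 / (-I * τ) ^ (1 / 2 : ℂ) * theta3 0 (-1 / τ) := by
  rw [theta3_eq_jacobiTheta₂ hτ, theta3_eq_jacobiTheta₂ (im_neg_one_div_pos hτ)]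
  simpa using jacobiTheta₂_functional_equation 0 τ

theorem theta4_zero_neg_one_div {τ : ℂ} (hτ : 0 < τ.im) :
    theta4 0 τ = 1 / (-I * τ) ^ (1 / 2 : ℂ) * theta2 0 (-1 / τ) := by
  have hπ : (π : ℂ) ≠ 0 := ofReal_ne_zero.2 Real.pi_ne_zero
  have hσ := im_neg_one_div_pos hτ
  rw [theta4_eq_theta3, theta3_eq_jacobiTheta₂ hτ, theta2_eq_theta3 hσ, theta3_eq_jacobiTheta₂ hσ,
    show (0 + π / 2) / (π : ℂ) = 1 / 2 by field_simp; ring, jacobiTheta₂_functional_equation,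
    ← jacobiTheta₂_neg_left (1 / 2 / τ), mul_assoc,
    show -(1 / 2 / τ) = (0 + π * (-1 / τ) / 2) / π by field_simp; ring,
    show -(π : ℂ) * I * (1 / 2) ^ 2 / τ = π * I * (-1 / τ) / 4 + I * 0 by ring]

theorem modulus_neg_one_div {τ : ℂ} (hτ : 0 < τ.im) : modulus (-1 / τ) = comodulus τ := by
  have hfactor : 1 / (-I * τ) ^ (1 / 2 : ℂ) ≠ 0 :=
    left_ne_zero_of_mul (theta3_zero_neg_one_div hτ ▸ (theta_zero_ne_zero hτ).2.1)
  rw [modulus, comodulus, theta3_zero_neg_one_div hτ, theta4_zero_neg_one_div hτ, mul_pow, mul_pow,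
    mul_div_mul_left _ _ (pow_ne_zero 2 hfactor)]

theorem comodulus_neg_one_div {τ : ℂ} (hτ : 0 < τ.im) : comodulus (-1 / τ) = modulus τ := by
  rw [← modulus_neg_one_div (im_neg_one_div_pos hτ)]
  simp only [neg_div, one_div, inv_neg, inv_inv, neg_neg]

theorem jacobiTriple_comodulus {τ : ℂ} (hτ : 0 < τ.im) :
    JacobiTriple 1 (comodulus τ ^ 2) (sn (comodulus τ)) (cn (comodulus τ)) (dn (comodulus τ)) :=
  modulus_neg_one_div hτ ▸ jacobiTriple_modulus (im_neg_one_div_pos hτ)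

theorem jacobiTriple_I_mul_modulus_div {τ l : ℂ} (hτ : 0 < τ.im)
    (hl : l = I * modulus τ / comodulus τ) : JacobiTriple 1 (l ^ 2) (sn l) (cn l) (dn l) :=
  (modulus_add_one hτ).trans hl.symm ▸ jacobiTriple_modulus (τ := τ + 1) (by simpa using hτ)

/-! ### Transformations of the Jacobi functions -/

theorem sn_modulus_eq_snTau {τ : ℂ} (hτ : 0 < τ.im) :
    sn (modulus τ) = snTau τ ∧ cn (modulus τ) = cnTau τ ∧ dn (modulus τ) = dnTau τ :=
  (jacobiTriple_modulus hτ).unique (jacobiTriple_tau hτ) rfl rfl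

theorem meromorphic_sn (k : ℂ) : Meromorphic (sn k) := meromorphic_regularize _

theorem meromorphic_cn (k : ℂ) : Meromorphic (cn k) := meromorphic_regularize _

theorem meromorphic_dn (k : ℂ) : Meromorphic (dn k) := meromorphic_regularize _

theorem ns_eq_inv_sn (k : ℂ) : ns k = fun z => (sn k z)⁻¹ := by
  have hsn : MeromorphicNFOn (sn k) Set.univ := meromorphicNFOn_regularize _
  simpa only [ns, one_div] using regularize_eq_self (meromorphicNFOn_fun_inv.2 hsn)

theorem cs_eq_inv_sc (k : ℂ) : cs k = fun z => (sc k z)⁻¹ := by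
  simpa only [cs, sc, inv_div] using
    regularize_inv ((meromorphic_sn k).fun_div (meromorphic_cn k))

theorem ds_eq_inv_sd (k : ℂ) : ds k = fun z => (sd k z)⁻¹ := by
  simpa only [ds, sd, inv_div] using
    regularize_inv ((meromorphic_sn k).fun_div (meromorphic_dn k))

/-- The three quotients by `cn`, those by `dn`, and the functions themselves, at modulus `k'`, each
solve the same Jacobi system as a triple at modulus `k` in the variable `iz`. The quotients by `sn`
are reciprocals of functions treated this way. -/
theorem imaginary_transformation {k k' : ℂ} (h : JacobiTriple 1 (k ^ 2) (sn k) (cn k) (dn k))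
    (h' : JacobiTriple 1 (k' ^ 2) (sn k') (cn k') (dn k')) (hkk' : k ^ 2 + k' ^ 2 = 1) (z : ℂ) :
    sc k' z = -I * sn k (I * z) ∧ nc k' z = cn k (I * z) ∧ dc k' z = dn k (I * z) ∧
    cs k' z = I * ns k (I * z) ∧ ds k' z = I * ds k (I * z) ∧ ns k' z = I * cs k (I * z) ∧
    nd k' z = cd k (I * z) ∧ cd k' z = nd k (I * z) ∧ sd k' z = -I * sd k (I * z) ∧
    cn k' z = nc k (I * z) ∧ sn k' z = -I * sc k (I * z) ∧ dn k' z = dc k (I * z) := by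
  obtain ⟨hsc, hnc, hdc⟩ : sc k' = _ ∧ nc k' = _ ∧ dc k' = _ :=
    h'.div_c.unique (h.rescale I_ne_zero) (by simp only [I_sq, mul_one])
      (by linear_combination hkk' - k ^ 2 * I_sq)
  obtain ⟨hsd, hnd, hcd⟩ : sd k' = _ ∧ nd k' = _ ∧ cd k' = _ :=
    h'.swap.div_c.unique (h.swap.div_c.swap.rescale I_ne_zero)
      (by linear_combination -hkk' - (1 - k ^ 2) * I_sq)
      (by linear_combination -hkk' + k ^ 2 * I_sq)
  obtain ⟨hsn, hcn, hdn⟩ := h'.unique (h.div_c.rescale I_ne_zero)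
    (by simp only [I_sq, mul_neg, neg_mul, one_mul, neg_neg])
    (by linear_combination hkk' - (k ^ 2 - 1) * I_sq)
  simp only [cs_eq_inv_sc, ds_eq_inv_sd, ns_eq_inv_sn, hsc, hnc, hdc, hsd, hnd, hcd, hsn, hcn, hdn,
    inv_I, mul_inv, inv_neg, neg_neg, true_and]
  exact ⟨rfl, rfl, rfl, rfl, rfl, rfl, rfl, rfl⟩

theorem translation_transformation {k k' l : ℂ}
    (h : JacobiTriple 1 (k ^ 2) (sn k) (cn k) (dn k))
    (h' : JacobiTriple 1 (l ^ 2) (sn l) (cn l) (dn l)) (hkk' : k ^ 2 + k' ^ 2 = 1)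
    (hk' : k' ≠ 0) (hl : l = I * k / k') (z : ℂ) :
    sd k z = sn l (k' * z) / k' ∧ cd k z = cn l (k' * z) ∧ nd k z = dn l (k' * z) := by
  have hsq : k' ^ 2 * l ^ 2 = -k ^ 2 := by
    rw [hl]
    field_simp
    linear_combination k ^ 2 * I_sq
  obtain ⟨hsd, hcd, hnd⟩ : sd k = _ ∧ cd k = _ ∧ nd k = _ :=
    h.swap.div_c.swap.unique (h'.rescale hk') (by linear_combination -hkk') hsq.symm
  simp only [hsd, hcd, hnd, inv_mul_eq_div, and_self]

/-! ### Moduli on the imaginary axis -/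

theorem nomePow_neg_conj (τ a : ℂ) : nomePow (-conj τ) (conj a) = conj (nomePow τ a) := by
  simp only [nomePow, ← exp_conj, map_mul, conj_ofReal, conj_I, mul_neg, neg_mul]

theorem theta2_zero_neg_conj (τ : ℂ) : theta2 0 (-conj τ) = conj (theta2 0 τ) := by
  simp [theta2, conj_tsum, ← nomePow_neg_conj, map_ofNat]

theorem theta3_zero_neg_conj (τ : ℂ) : theta3 0 (-conj τ) = conj (theta3 0 τ) := by
  simp [theta3, conj_tsum, ← nomePow_neg_conj, map_ofNat]

theorem theta4_zero_neg_conj (τ : ℂ) : theta4 0 (-conj τ) = conj (theta4 0 τ) := by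
  simp [theta4, conj_tsum, ← nomePow_neg_conj, map_ofNat]

theorem eq_ofReal_re_of_neg_conj {f : ℂ → ℂ} (hf : ∀ τ, f (-conj τ) = conj (f τ)) (t : ℝ) :
    f (I * t) = (f (I * t)).re :=
  (conj_eq_iff_re.1 (by simp [← hf])).symm

theorem modulus_I_mul (t : ℝ) :
    modulus (I * t) = ((theta2 0 (I * t)).re ^ 2 / (theta3 0 (I * t)).re ^ 2 : ℝ) := by
  rw [modulus, eq_ofReal_re_of_neg_conj theta2_zero_neg_conj,
    eq_ofReal_re_of_neg_conj theta3_zero_neg_conj]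
  push_cast
  rfl

theorem comodulus_I_mul (t : ℝ) :
    comodulus (I * t) = ((theta4 0 (I * t)).re ^ 2 / (theta3 0 (I * t)).re ^ 2 : ℝ) := by
  rw [comodulus, eq_ofReal_re_of_neg_conj theta4_zero_neg_conj,
    eq_ofReal_re_of_neg_conj theta3_zero_neg_conj]
  push_cast
  rfl

theorem comodulus_I_mul_eq_sqrt {t k : ℝ} (ht : 0 < t) (hk : modulus (I * t) = k) :
    comodulus (I * t) = (√(1 - k ^ 2) : ℝ) := by
  have hsq := modulus_sq_add_comodulus_sq (τ := I * t) (by simpa using ht)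
  rw [hk, comodulus_I_mul] at hsq
  norm_cast at hsq
  rw [comodulus_I_mul, ← hsq, add_sub_cancel_left, Real.sqrt_sq (by positivity)]

theorem continuousAt_modulus {τ : ℂ} (hτ : 0 < τ.im) : ContinuousAt modulus τ := by
  have him : ∀ᶠ σ : ℂ in 𝓝 τ, 0 < σ.im := continuous_im.continuousAt.eventually_const_lt hτ
  have htheta3 {u : ℂ → ℂ} (hu : ContinuousAt u τ) : ContinuousAt (fun σ => theta3 (u σ) σ) τ :=
    (ContinuousAt.comp (f := fun σ => (u σ / π, σ)) (continuousAt_jacobiTheta₂ _ hτ)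
      (by fun_prop)).congr (him.mono fun σ hσ => (theta3_eq_jacobiTheta₂ hσ (u σ)).symm)
  have htheta2 : ContinuousAt (fun σ => theta2 0 σ) τ :=
    (ContinuousAt.mul (by fun_prop) (htheta3 (by fun_prop))).congr
      (him.mono fun σ hσ => (theta2_eq_theta3 hσ 0).symm)
  exact (htheta2.pow 2).div ((htheta3 continuousAt_const).pow 2)
    (pow_ne_zero 2 (theta_zero_ne_zero hτ).2.1)

theorem tendsto_modulus : Tendsto modulus (comap im atTop) (𝓝 0) := by
  have htheta2 : Tendsto (fun τ => theta2 0 τ) (comap im atTop) (𝓝 0) := by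
    simpa [mul_div_cancel₀, nomePow] using
      (tendsto_nomePow_ofReal (a := 1 / 4) (by norm_num)).mul tendsto_theta2_zero
  simpa using! (htheta2.pow 2).div (tendsto_theta3_zero.pow 2) (by simp)

theorem tendsto_comodulus : Tendsto comodulus (comap im atTop) (𝓝 1) := by
  simpa using! (tendsto_theta4_zero.pow 2).div (tendsto_theta3_zero.pow 2) (by simp)

theorem tendsto_I_mul_ofReal_comap_im_atTop :
    Tendsto (fun t : ℝ => I * (t : ℂ)) atTop (comap im atTop) :=
  tendsto_comap_iff.2 (tendsto_id.congr fun t => by simp)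

theorem tendsto_re_modulus_I_mul_atTop :
    Tendsto (fun t : ℝ => (modulus (I * t)).re) atTop (𝓝 0) :=
  (continuous_re.tendsto 0).comp (tendsto_modulus.comp tendsto_I_mul_ofReal_comap_im_atTop)

theorem tendsto_re_modulus_I_mul_nhdsGT_zero :
    Tendsto (fun t : ℝ => (modulus (I * t)).re) (𝓝[>] 0) (𝓝 1) := by
  refine ((continuous_re.tendsto 1).comp ((tendsto_comodulus.comp
    tendsto_I_mul_ofReal_comap_im_atTop).comp tendsto_inv_nhdsGT_zero)).congr' ?_
  filter_upwards [self_mem_nhdsWithin] with t ht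
  have hne : (t : ℂ) ≠ 0 := ofReal_ne_zero.2 (ne_of_gt ht)
  have hinv : -1 / (I * ((t⁻¹ : ℝ) : ℂ)) = I * t := by
    push_cast
    field_simp
    rw [I_sq]
  rw [Function.comp_apply, Function.comp_apply, Function.comp_apply,
    ← modulus_neg_one_div (by simpa using ht), hinv]

theorem exists_modulus_I_mul_eq {k : ℝ} (h0 : 0 < k) (h1 : k < 1) :
    ∃ t : ℝ, 0 < t ∧ modulus (I * t) = k := by
  have hcont : ContinuousOn (fun t : ℝ => (modulus (I * t)).re) (Set.Ioi 0) := fun t ht =>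
    (continuous_re.continuousAt.comp (ContinuousAt.comp (f := fun t : ℝ => I * (t : ℂ))
      (continuousAt_modulus (by simpa using ht)) (by fun_prop))).continuousWithinAt
  obtain ⟨t, ht, hk⟩ := isPreconnected_Ioi.intermediate_value_Ioo
    (le_principal_iff.2 (Ioi_mem_atTop 0)) (le_principal_iff.2 self_mem_nhdsWithin) hcont
    tendsto_re_modulus_I_mul_atTop tendsto_re_modulus_I_mul_nhdsGT_zero ⟨h0, h1⟩
  refine ⟨t, ht, ?_⟩
  simp only [modulus_I_mul, ofReal_re] at hk ⊢
  rw [hk]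

/-! ### Brackets of meromorphic vector fields -/

theorem eventually_differentiableAt {f : ℂ → ℂ} (hf : Meromorphic f) :
    ∀ᶠ z in codiscrete ℂ, DifferentiableAt ℂ f z :=
  (MeromorphicOn.eventually_codiscreteWithin_analyticAt f (hf.meromorphicOn (s := Set.univ))).mono
    fun _ hz => hz.differentiableAt

theorem wittBracket_eq_of_hasDerivAt {f g : ℂ → ℂ} {f' g' z : ℂ} (hf : HasDerivAt f f' z)
    (hg : HasDerivAt g g' z) : wittBracket f g z = f z * g' - g z * f' := by
  rw [wittBracket, hf.deriv, hg.deriv]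

theorem wittBracket_self (f : ℂ → ℂ) (z : ℂ) : wittBracket f f z = 0 :=
  sub_self _

theorem wittBracket_swap (f g : ℂ → ℂ) (z : ℂ) : wittBracket f g z = -wittBracket g f z :=
  (neg_sub _ _).symm

theorem wittBracket_const_mul (a b : ℂ) (f g : ℂ → ℂ) (z : ℂ) :
    wittBracket (fun z => a * f z) (fun z => b * g z) z = a * b * wittBracket f g z := by
  simp only [wittBracket, deriv_const_mul_field]
  ring

theorem wittBracket_comp_const_mul (a : ℂ) (f g : ℂ → ℂ) (z : ℂ) :
    wittBracket (fun z => f (a * z)) (fun z => g (a * z)) z = a * wittBracket f g (a * z) := by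
  simp only [wittBracket, deriv_comp_mul_left, smul_eq_mul]
  ring

theorem wittBracket_add_right {f g h : ℂ → ℂ} {z : ℂ} (a b : ℂ) (hg : DifferentiableAt ℂ g z)
    (hh : DifferentiableAt ℂ h z) :
    wittBracket f (fun z => a * g z + b * h z) z =
      a * wittBracket f g z + b * wittBracket f h z := by
  have hderiv : deriv (fun z => a * g z + b * h z) z = a * deriv g z + b * deriv h z :=
    ((hg.hasDerivAt.const_mul a).add (hh.hasDerivAt.const_mul b)).deriv
  simp only [wittBracket, hderiv]
  ring

theorem wittBracket_div {f g h : ℂ → ℂ} {z : ℂ} (hf : DifferentiableAt ℂ f z)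
    (hg : DifferentiableAt ℂ g z) (hh : DifferentiableAt ℂ h z) (hz : h z ≠ 0) :
    wittBracket (fun z => f z / h z) (fun z => g z / h z) z = wittBracket f g z / h z ^ 2 := by
  refine (wittBracket_eq_of_hasDerivAt (hf.hasDerivAt.div hh.hasDerivAt hz)
    (hg.hasDerivAt.div hh.hasDerivAt hz)).trans ?_
  simp only [wittBracket, Pi.div_apply]
  field_simp
  ring

theorem wittBracket_congr {f f' g g' : ℂ → ℂ} (hf : f =ᶠ[codiscrete ℂ] f')
    (hg : g =ᶠ[codiscrete ℂ] g') : wittBracket f g =ᶠ[codiscrete ℂ] wittBracket f' g' := by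
  filter_upwards [eventually_eventually_nhds_of_codiscrete hf,
    eventually_eventually_nhds_of_codiscrete hg] with z hf hg
  rw [wittBracket, wittBracket, EventuallyEq.deriv_eq hf, EventuallyEq.deriv_eq hg,
    hf.self_of_nhds, hg.self_of_nhds]

/-- Nonzero meromorphic vector fields `X d/dz`, `Y d/dz`, `Z d/dz` with `[X, Y] = a Z`,
`[Y, Z] = b X`, `[Z, X] = c Y`. The Cayley-Klein relations for `(J, P₁, P₂)` are the case
`(a, b, c) = (1, κ₁, κ₂)`. -/
structure BracketTriple (X Y Z : ℂ → ℂ) (a b c : ℂ) : Prop where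
  meromorphic_X : Meromorphic X
  meromorphic_Y : Meromorphic Y
  meromorphic_Z : Meromorphic Z
  X_ne_zero : ∀ᶠ z in codiscrete ℂ, X z ≠ 0
  Y_ne_zero : ∀ᶠ z in codiscrete ℂ, Y z ≠ 0
  Z_ne_zero : ∀ᶠ z in codiscrete ℂ, Z z ≠ 0
  bracket_X_Y : ∀ᶠ z in codiscrete ℂ, wittBracket X Y z = a * Z z
  bracket_Y_Z : ∀ᶠ z in codiscrete ℂ, wittBracket Y Z z = b * X z
  bracket_Z_X : ∀ᶠ z in codiscrete ℂ, wittBracket Z X z = c * Y z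

namespace BracketTriple

variable {X Y Z : ℂ → ℂ} {a b c : ℂ}

theorem rotate (h : BracketTriple X Y Z a b c) : BracketTriple Y Z X b c a where
  meromorphic_X := h.meromorphic_Y
  meromorphic_Y := h.meromorphic_Z
  meromorphic_Z := h.meromorphic_X
  X_ne_zero := h.Y_ne_zero
  Y_ne_zero := h.Z_ne_zero
  Z_ne_zero := h.X_ne_zero
  bracket_X_Y := h.bracket_Y_Z
  bracket_Y_Z := h.bracket_Z_X
  bracket_Z_X := h.bracket_X_Y

theorem swap (h : BracketTriple X Y Z a b c) : BracketTriple Y X Z (-a) (-c) (-b) where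
  meromorphic_X := h.meromorphic_Y
  meromorphic_Y := h.meromorphic_X
  meromorphic_Z := h.meromorphic_Z
  X_ne_zero := h.Y_ne_zero
  Y_ne_zero := h.X_ne_zero
  Z_ne_zero := h.Z_ne_zero
  bracket_X_Y := h.bracket_X_Y.mono fun z hz => by rw [wittBracket_swap, hz, neg_mul]
  bracket_Y_Z := h.bracket_Z_X.mono fun z hz => by rw [wittBracket_swap, hz, neg_mul]
  bracket_Z_X := h.bracket_Y_Z.mono fun z hz => by rw [wittBracket_swap, hz, neg_mul]

theorem scale (h : BracketTriple X Y Z a b c) {X' Y' Z' : ℂ → ℂ} {α β γ a' b' c' : ℂ}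
    (hα : α ≠ 0) (hβ : β ≠ 0) (hγ : γ ≠ 0) (hX : ∀ z, X' z = α * X z)
    (hY : ∀ z, Y' z = β * Y z) (hZ : ∀ z, Z' z = γ * Z z) (ha : α * β * a = γ * a')
    (hb : β * γ * b = α * b') (hc : γ * α * c = β * c') : BracketTriple X' Y' Z' a' b' c' := by
  obtain rfl : X' = fun z => α * X z := funext hX
  obtain rfl : Y' = fun z => β * Y z := funext hY
  obtain rfl : Z' = fun z => γ * Z z := funext hZ
  exact {
    meromorphic_X := (Meromorphic.const α).fun_mul h.meromorphic_X
    meromorphic_Y := (Meromorphic.const β).fun_mul h.meromorphic_Y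
    meromorphic_Z := (Meromorphic.const γ).fun_mul h.meromorphic_Z
    X_ne_zero := h.X_ne_zero.mono fun z => mul_ne_zero hα
    Y_ne_zero := h.Y_ne_zero.mono fun z => mul_ne_zero hβ
    Z_ne_zero := h.Z_ne_zero.mono fun z => mul_ne_zero hγ
    bracket_X_Y := h.bracket_X_Y.mono fun z hz => by
      rw [wittBracket_const_mul, hz]
      linear_combination Z z * ha
    bracket_Y_Z := h.bracket_Y_Z.mono fun z hz => by
      rw [wittBracket_const_mul, hz]
      linear_combination X z * hb
    bracket_Z_X := h.bracket_Z_X.mono fun z hz => by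
      rw [wittBracket_const_mul, hz]
      linear_combination Y z * hc }

theorem regularize (h : BracketTriple X Y Z a b c) :
    BracketTriple (regularize X) (regularize Y) (regularize Z) a b c := by
  have hX := regularize_eventuallyEq h.meromorphic_X
  have hY := regularize_eventuallyEq h.meromorphic_Y
  have hZ := regularize_eventuallyEq h.meromorphic_Z
  refine ⟨meromorphic_regularize X, meromorphic_regularize Y, meromorphic_regularize Z, ?_, ?_, ?_,
    ?_, ?_, ?_⟩
  · filter_upwards [hX, h.X_ne_zero] with z hX hne using hX ▸ hne
  · filter_upwards [hY, h.Y_ne_zero] with z hY hne using hY ▸ hne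
  · filter_upwards [hZ, h.Z_ne_zero] with z hZ hne using hZ ▸ hne
  · filter_upwards [wittBracket_congr hX hY, hZ, h.bracket_X_Y] with z hXY hZ hz
    rw [hXY, hZ, hz]
  · filter_upwards [wittBracket_congr hY hZ, hX, h.bracket_Y_Z] with z hYZ hX hz
    rw [hYZ, hX, hz]
  · filter_upwards [wittBracket_congr hZ hX, hY, h.bracket_Z_X] with z hZX hY hz
    rw [hZX, hY, hz]

/-- Bracketing the relation first with `X` and then with `Y` leaves `q a b X = 0`. -/
theorem middle_coeff_eq_zero (h : BracketTriple X Y Z a b c) (ha : a ≠ 0) (hb : b ≠ 0) {p q r : ℂ}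
    (hrel : (fun z => p * X z + q * Y z + r * Z z) =ᶠ[codiscrete ℂ] fun _ => 0) : q = 0 := by
  have dY := eventually_differentiableAt h.meromorphic_Y
  have dZ := eventually_differentiableAt h.meromorphic_Z
  have hrelX : (fun z => q * a * Z z + -(r * c) * Y z) =ᶠ[codiscrete ℂ] fun _ => 0 := by
    have hsolve : (fun z => q * Y z + r * Z z) =ᶠ[codiscrete ℂ] fun z => -p * X z :=
      hrel.mono fun z hz => by linear_combination hz
    filter_upwards [wittBracket_congr (.refl _ X) hsolve, dY, dZ, h.bracket_X_Y, h.bracket_Z_X]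
      with z hz dY dZ hXY hZX
    have hXX : wittBracket X (fun z => -p * X z) z = 0 := by
      simpa [wittBracket_self] using wittBracket_const_mul 1 (-p) X X z
    rw [wittBracket_add_right q r dY dZ, hXX, hXY, wittBracket_swap X Z, hZX] at hz
    linear_combination hz
  have hrelXY : ∀ᶠ z in codiscrete ℂ, q * a * (b * X z) = 0 := by
    filter_upwards [wittBracket_congr (.refl _ Y) hrelX, dY, dZ, h.bracket_Y_Z]
      with z hz dY dZ hYZ
    rw [wittBracket_add_right _ _ dZ dY, hYZ, wittBracket_self] at hz
    simpa [wittBracket] using hz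
  obtain ⟨z, hz, hne⟩ := (eventually_codiscrete_iff.1 (hrelXY.and h.X_ne_zero) 0).exists
  simpa [ha, hb, hne] using hz

theorem isWittRealization {T : CKType} {G : Generators}
    (h : BracketTriple G.J G.P₁ G.P₂ 1 T.curv1 T.curv2) : IsWittRealization T G where
  meromorphic_J := h.meromorphic_X
  meromorphic_P₁ := h.meromorphic_Y
  meromorphic_P₂ := h.meromorphic_Z
  bracket_J_P₁ := h.bracket_X_Y.mono fun z hz => hz.trans (one_mul _)
  bracket_J_P₂ := h.bracket_Z_X.mono fun z hz => by
    rw [wittBracket_swap, hz]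
    exact (neg_mul _ _).symm
  bracket_P₁_P₂ := h.bracket_Y_Z
  independent p q r hrel := by
    have hcurv1 : T.curv1 ≠ 0 := by cases T <;> simp [CKType.curv1]
    have hcurv2 : T.curv2 ≠ 0 := by cases T <;> simp [CKType.curv2]
    refine ⟨h.rotate.rotate.middle_coeff_eq_zero (p := r) (r := q) hcurv2 one_ne_zero ?_,
      h.middle_coeff_eq_zero one_ne_zero hcurv1 hrel,
      h.rotate.middle_coeff_eq_zero (p := q) (r := p) hcurv1 hcurv2 ?_⟩
    all_goals exact hrel.mono fun z hz => by linear_combination hz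

end BracketTriple

theorem wittBracket_changeVar {c : ℂ} (hc : c ≠ 0) (f g : ℂ → ℂ) (u : ℂ) :
    wittBracket (fun u => c * f (u / c)) (fun u => c * g (u / c)) u =
      c * wittBracket f g (u / c) := by
  simp only [wittBracket_const_mul, div_eq_inv_mul, wittBracket_comp_const_mul]
  field_simp

theorem IsWittRealization.changeVar {T : CKType} {G : Generators} (h : IsWittRealization T G)
    {c : ℂ} (hc : c ≠ 0) : IsWittRealization T (G.changeVar c) := by
  have hdiv : Tendsto (fun u => u / c) (codiscrete ℂ) (codiscrete ℂ) :=
    tendsto_codiscrete_of_injective (continuous_id.div_const c) fun _ _ => (div_left_inj' hc).1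
  have hmero {f : ℂ → ℂ} (hf : Meromorphic f) : Meromorphic fun u => c * f (u / c) :=
    (Meromorphic.const c).fun_mul fun x =>
      (hf (x / c)).comp_analyticAt (g := fun u => u / c) (by fun_prop)
  refine ⟨hmero h.meromorphic_J, hmero h.meromorphic_P₁, hmero h.meromorphic_P₂, ?_, ?_, ?_,
    fun p q r hrel => h.independent p q r ?_⟩
  · filter_upwards [hdiv.eventually h.bracket_J_P₁] with u hu
    exact (wittBracket_changeVar hc _ _ u).trans (congrArg (c * ·) hu)
  · filter_upwards [hdiv.eventually h.bracket_J_P₂] with u hu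
    exact (wittBracket_changeVar hc _ _ u).trans (by rw [hu, mul_left_comm]; rfl)
  · filter_upwards [hdiv.eventually h.bracket_P₁_P₂] with u hu
    exact (wittBracket_changeVar hc _ _ u).trans (by rw [hu, mul_left_comm]; rfl)
  · have hmul : Tendsto (fun z => c * z) (codiscrete ℂ) (codiscrete ℂ) :=
      tendsto_codiscrete_of_injective (continuous_const_mul c) (mul_right_injective₀ hc)
    filter_upwards [hmul.eventually hrel] with z hz
    simp only [Generators.changeVar, mul_div_cancel_left₀ _ hc] at hz
    refine (mul_eq_zero.1 ?_).resolve_left hc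
    linear_combination hz

/-! ### Realizations by Jacobi functions -/

namespace JacobiTriple

variable {α β : ℂ} {s c d : ℂ → ℂ}

theorem bracketTriple (h : JacobiTriple α β s c d) : BracketTriple s c d (-1) (α - β) 1 := by
  refine ⟨h.meromorphic_s, h.meromorphic_c, h.meromorphic_d, h.s_ne_zero, h.c_ne_zero, h.d_ne_zero,
    ?_, ?_, ?_⟩
  · filter_upwards [h.deriv_s, h.deriv_c, h.sq_c] with z hs hc hsq
    rw [wittBracket_eq_of_hasDerivAt hs hc]
    linear_combination -d z * hsq
  · filter_upwards [h.deriv_c, h.deriv_d, h.sq_c, h.sq_d] with z hc hd hsq hsq'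
    rw [wittBracket_eq_of_hasDerivAt hc hd]
    linear_combination s z * (α * hsq' - β * hsq)
  · filter_upwards [h.deriv_s, h.deriv_d, h.sq_d] with z hs hd hsq
    rw [wittBracket_eq_of_hasDerivAt hd hs]
    linear_combination c z * hsq

theorem bracketTriple_div_s (h : JacobiTriple α β s c d) :
    BracketTriple (fun z => 1 / s z) (fun z => c z / s z) (fun z => d z / s z) (-α) (α - β) β := by
  refine ⟨(Meromorphic.const 1).fun_div h.meromorphic_s, h.meromorphic_c.fun_div h.meromorphic_s,
    h.meromorphic_d.fun_div h.meromorphic_s, ?_, ?_, ?_, ?_, ?_, ?_⟩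
  · exact h.s_ne_zero.mono fun z hs => one_div_ne_zero hs
  · filter_upwards [h.c_ne_zero, h.s_ne_zero] with z using div_ne_zero
  · filter_upwards [h.d_ne_zero, h.s_ne_zero] with z using div_ne_zero
  · filter_upwards [h.deriv_s, h.deriv_c, h.s_ne_zero] with z hs hc hne
    rw [wittBracket_div (differentiableAt_const 1) hc.differentiableAt hs.differentiableAt hne,
      wittBracket_eq_of_hasDerivAt (hasDerivAt_const z 1) hc]
    field_simp
    ring
  · filter_upwards [h.deriv_s, h.deriv_c, h.deriv_d, h.bracketTriple.bracket_Y_Z, h.s_ne_zero]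
      with z hs hc hd hbracket hne
    rw [wittBracket_div hc.differentiableAt hd.differentiableAt hs.differentiableAt hne, hbracket]
    field_simp
  · filter_upwards [h.deriv_s, h.deriv_d, h.s_ne_zero] with z hs hd hne
    rw [wittBracket_div hd.differentiableAt (differentiableAt_const 1) hs.differentiableAt hne,
      wittBracket_eq_of_hasDerivAt hd (hasDerivAt_const z 1)]
    field_simp
    ring

end JacobiTriple

section families

variable {k k' : ℂ}

theorem isWittRealization_basicFamily (h : JacobiTriple 1 (k ^ 2) (sn k) (cn k) (dn k))
    (hk' : k' ≠ 0) (hkk' : k ^ 2 + k' ^ 2 = 1) (T : CKType) :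
    IsWittRealization T (basicFamily k k' T) := by
  have hI := I_sq
  have hbracket := h.bracketTriple
  apply BracketTriple.isWittRealization
  cases T <;> simp only [basicFamily, CKType.curv1, CKType.curv2]
  case' elliptic => apply hbracket.rotate.swap.scale (α := -1 / k') (β := I / k') (γ := I)
  case' hyperbolic => apply hbracket.rotate.swap.scale (α := -1 / k') (β := 1 / k') (γ := 1)
  case' coHyperbolic => apply hbracket.rotate.scale (α := 1 / k') (β := 1 / k') (γ := 1)
  case' doublyHyperbolic =>
    apply hbracket.rotate.rotate.swap.scale (α := 1) (β := -I / k') (γ := I / k')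
  all_goals grind [I_ne_zero]

theorem isWittRealization_cFamily (h : JacobiTriple 1 (k ^ 2) (sn k) (cn k) (dn k)) (hk : k ≠ 0)
    (T : CKType) : IsWittRealization T (cFamily k T) := by
  have hI := I_sq
  have hbracket : BracketTriple (sc k) (nc k) (dc k) _ _ _ := h.div_c.bracketTriple
  apply BracketTriple.isWittRealization
  cases T <;> simp only [cFamily, CKType.curv1, CKType.curv2]
  case' elliptic => apply hbracket.rotate.swap.scale (α := I / k) (β := 1 / k) (γ := I)
  case' hyperbolic => apply hbracket.rotate.rotate.scale (α := I / k) (β := -1) (γ := -I / k)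
  case' coHyperbolic => apply hbracket.rotate.swap.scale (α := 1 / k) (β := 1 / k) (γ := 1)
  case' doublyHyperbolic => apply hbracket.rotate.swap.scale (α := 1 / k) (β := I / k) (γ := I)
  all_goals grind [I_ne_zero]

theorem isWittRealization_sFamily (h : JacobiTriple 1 (k ^ 2) (sn k) (cn k) (dn k)) (hk : k ≠ 0)
    (hk' : k' ≠ 0) (hkk' : k ^ 2 + k' ^ 2 = 1) (T : CKType) :
    IsWittRealization T (sFamily k k' T) := by
  have hI := I_sq
  have hbracket : BracketTriple (ns k) (cs k) (ds k) _ _ _ := h.bracketTriple_div_s.regularize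
  apply BracketTriple.isWittRealization
  cases T <;> simp only [sFamily, CKType.curv1, CKType.curv2]
  case' elliptic => apply hbracket.scale (α := I / k) (β := I / k') (γ := 1 / (k * k'))
  case' hyperbolic =>
    apply hbracket.rotate.rotate.scale (α := 1 / (k * k')) (β := 1 / k) (γ := 1 / k')
  case' coHyperbolic => apply hbracket.rotate.scale (α := 1 / k') (β := 1 / (k * k')) (γ := 1 / k)
  case' doublyHyperbolic => apply hbracket.scale (α := 1 / k) (β := 1 / k') (γ := -1 / (k * k'))
  all_goals grind [I_ne_zero]

theorem isWittRealization_dFamily (h : JacobiTriple 1 (k ^ 2) (sn k) (cn k) (dn k)) (T : CKType) :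
    IsWittRealization T (dFamily k T) := by
  have hI := I_sq
  have hbracket : BracketTriple (sd k) (cd k) (nd k) _ _ _ := h.swap.div_c.swap.bracketTriple
  apply BracketTriple.isWittRealization
  cases T <;> simp only [dFamily, CKType.curv1, CKType.curv2]
  case' elliptic => apply hbracket.rotate.swap.scale (α := -1) (β := I) (γ := I)
  case' hyperbolic => apply hbracket.rotate.rotate.scale (α := 1) (β := 1) (γ := 1)
  case' coHyperbolic => apply hbracket.rotate.rotate.scale (α := I) (β := I) (γ := -1)
  case' doublyHyperbolic => apply hbracket.rotate.rotate.swap.scale (α := 1) (β := -I) (γ := I)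
  all_goals grind [I_ne_zero]

end families

theorem isWittRealization_families_comodulus {τ : ℂ} (hτ : 0 < τ.im) (T : CKType) :
    IsWittRealization T (basicFamily (comodulus τ) (modulus τ) T) ∧
    IsWittRealization T (cFamily (comodulus τ) T) ∧
    IsWittRealization T (sFamily (comodulus τ) (modulus τ) T) ∧
    IsWittRealization T (dFamily (comodulus τ) T) ∧
    IsWittRealization T ((basicFamily (comodulus τ) (modulus τ) T).changeVar I) ∧
    IsWittRealization T ((cFamily (comodulus τ) T).changeVar I) ∧
    IsWittRealization T ((sFamily (comodulus τ) (modulus τ) T).changeVar I) ∧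
    IsWittRealization T ((dFamily (comodulus τ) T).changeVar I) := by
  have h := jacobiTriple_comodulus hτ
  have hk := modulus_ne_zero hτ
  have hk' := comodulus_ne_zero hτ
  have hsq : comodulus τ ^ 2 + modulus τ ^ 2 = 1 :=
    (add_comm _ _).trans (modulus_sq_add_comodulus_sq hτ)
  have hbasic := isWittRealization_basicFamily h hk hsq T
  have hc := isWittRealization_cFamily h hk' T
  have hs := isWittRealization_sFamily h hk' hk hsq T
  have hd := isWittRealization_dFamily h T
  exact ⟨hbasic, hc, hs, hd, hbasic.changeVar I_ne_zero, hc.changeVar I_ne_zero,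
    hs.changeVar I_ne_zero, hd.changeVar I_ne_zero⟩

theorem cFamily_elliptic_changeVar_I {k k' : ℂ} (h : JacobiTriple 1 (k ^ 2) (sn k) (cn k) (dn k))
    (h' : JacobiTriple 1 (k' ^ 2) (sn k') (cn k') (dn k')) (hkk' : k ^ 2 + k' ^ 2 = 1) :
    (cFamily k' .elliptic).changeVar I =
      ⟨fun ζ => -(1 / k') * dn k ζ, fun ζ => I * (1 / k') * cn k ζ, fun ζ => I * sn k ζ⟩ := by
  have htable (ζ : ℂ) := imaginary_transformation h h' hkk' (ζ / I)
  simp only [mul_div_cancel₀ _ I_ne_zero] at htable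
  simp only [Generators.changeVar, cFamily, Generators.mk.injEq]
  refine ⟨funext fun ζ => ?_, funext fun ζ => ?_, funext fun ζ => ?_⟩
  · rw [(htable ζ).2.2.1]
    linear_combination dn k ζ / k' * I_sq
  · rw [(htable ζ).2.1]
    ring
  · rw [(htable ζ).1]
    linear_combination -I * sn k ζ * I_sq

theorem dFamily_changeVar {k k' l : ℂ} (h : JacobiTriple 1 (k ^ 2) (sn k) (cn k) (dn k))
    (h' : JacobiTriple 1 (l ^ 2) (sn l) (cn l) (dn l)) (hkk' : k ^ 2 + k' ^ 2 = 1) (hk' : k' ≠ 0)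
    (hl : l = I * k / k') (T : CKType) : (dFamily k T).changeVar k' = lambdaFamily l k' T := by
  have htable (u : ℂ) := translation_transformation h h' hkk' hk' hl (u / k')
  simp only [mul_div_cancel₀ _ hk'] at htable
  cases T <;>
  · simp only [Generators.changeVar, dFamily, lambdaFamily, Generators.mk.injEq]
    refine ⟨funext fun u => ?_, funext fun u => ?_, funext fun u => ?_⟩ <;>
    · simp only [htable u]
      try field_simp

theorem image_norm_I_mul_div_sqrt_Ioo :
    (fun k : ℝ => ‖I * (k : ℂ) / ((√(1 - k ^ 2) : ℝ) : ℂ)‖) '' Set.Ioo 0 1 = Set.Ioi 0 := by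
  have hnorm {k : ℝ} (hk : 0 < k) :
      ‖I * (k : ℂ) / ((√(1 - k ^ 2) : ℝ) : ℂ)‖ = k / √(1 - k ^ 2) := by
    simp [abs_of_pos hk, abs_of_nonneg (Real.sqrt_nonneg _)]
  refine Set.Subset.antisymm ?_ fun x (hx : 0 < x) => ?_
  · rintro _ ⟨k, ⟨hk0, hk1⟩, rfl⟩
    exact (div_pos hk0 (Real.sqrt_pos.2 (by nlinarith))).trans_eq (hnorm hk0).symm
  · have hroot : 0 < √(1 + x ^ 2) := by positivity
    have hroot_sq : √(1 + x ^ 2) ^ 2 = 1 + x ^ 2 := Real.sq_sqrt (by positivity)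
    have hk0 : 0 < x / √(1 + x ^ 2) := div_pos hx hroot
    have hk1 : x / √(1 + x ^ 2) < 1 := (div_lt_one hroot).2 (Real.lt_sqrt_of_sq_lt (by linarith))
    have hk' : √(1 - (x / √(1 + x ^ 2)) ^ 2) = 1 / √(1 + x ^ 2) := by
      rw [Real.sqrt_eq_iff_mul_self_eq_of_pos (by positivity)]
      field_simp
      linarith
    refine ⟨x / √(1 + x ^ 2), ⟨hk0, hk1⟩, (hnorm hk0).trans ?_⟩
    rw [hk']
    field_simp

end JacobiElliptic

theorem mainTheorem3_general :
    (∀ τ : ℂ, 0 < τ.im →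
      sn (modulus τ) = snTau τ ∧ cn (modulus τ) = cnTau τ ∧ dn (modulus τ) = dnTau τ) ∧
    (∀ k : ℝ, 0 < k → k < 1 → ∃ t : ℝ, 0 < t ∧
      modulus (I * (t : ℂ)) = (k : ℂ) ∧ comodulus (I * (t : ℂ)) = ((√(1 - k ^ 2) : ℝ) : ℂ)) ∧
    (∀ τ k k' : ℂ, 0 < τ.im → k = modulus τ → k' = comodulus τ →
      modulus (-1 / τ) = k' ∧ comodulus (-1 / τ) = k ∧
      ∀ z : ℂ,
        sc k' z = -I * sn k (I * z) ∧ nc k' z = cn k (I * z) ∧ dc k' z = dn k (I * z) ∧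
        cs k' z = I * ns k (I * z) ∧ ds k' z = I * ds k (I * z) ∧ ns k' z = I * cs k (I * z) ∧
        nd k' z = cd k (I * z) ∧ cd k' z = nd k (I * z) ∧ sd k' z = -I * sd k (I * z) ∧
        cn k' z = nc k (I * z) ∧ sn k' z = -I * sc k (I * z) ∧ dn k' z = dc k (I * z)) ∧
    (∀ τ k k' l : ℂ, 0 < τ.im → k = modulus τ → k' = comodulus τ → l = I * k / k' →
      k ^ 2 + k' ^ 2 = 1 ∧ k ≠ 0 ∧ k' ≠ 0 ∧
      modulus (τ + 1) = l ∧ comodulus (τ + 1) = 1 / k' ∧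
      ∀ z : ℂ,
        sd k z = sn l (k' * z) / k' ∧ cd k z = cn l (k' * z) ∧ nd k z = dn l (k' * z)) ∧
    (∀ τ k k' : ℂ, 0 < τ.im → k = modulus τ → k' = comodulus τ →
      (∀ T : CKType,
        IsWittRealization T (basicFamily k' k T) ∧
        IsWittRealization T (cFamily k' T) ∧
        IsWittRealization T (sFamily k' k T) ∧
        IsWittRealization T (dFamily k' T) ∧
        IsWittRealization T ((basicFamily k' k T).changeVar I) ∧
        IsWittRealization T ((cFamily k' T).changeVar I) ∧
        IsWittRealization T ((sFamily k' k T).changeVar I) ∧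
        IsWittRealization T ((dFamily k' T).changeVar I)) ∧
      (cFamily k' .elliptic).changeVar I =
        ⟨fun ζ => -(1 / k') * dn k ζ, fun ζ => I * (1 / k') * cn k ζ,
          fun ζ => I * sn k ζ⟩) ∧
    (∀ τ k k' : ℂ, 0 < τ.im → k = modulus τ → k' = comodulus τ → ∀ T : CKType,
      (dFamily k T).changeVar k' = lambdaFamily (I * k / k') k' T ∧
      IsWittRealization T (lambdaFamily (I * k / k') k' T)) ∧
    (fun k : ℝ => ‖I * (k : ℂ) / ((√(1 - k ^ 2) : ℝ) : ℂ)‖) '' Set.Ioo 0 1 = Set.Ioi 0 := by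
  refine ⟨fun τ hτ => sn_modulus_eq_snTau hτ, fun k h0 h1 => ?_, ?_, ?_, ?_, ?_,
    image_norm_I_mul_div_sqrt_Ioo⟩
  · obtain ⟨t, ht, hk⟩ := exists_modulus_I_mul_eq h0 h1
    exact ⟨t, ht, hk, comodulus_I_mul_eq_sqrt ht hk⟩
  · rintro τ k k' hτ rfl rfl
    exact ⟨modulus_neg_one_div hτ, comodulus_neg_one_div hτ, imaginary_transformation
      (jacobiTriple_modulus hτ) (jacobiTriple_comodulus hτ) (modulus_sq_add_comodulus_sq hτ)⟩
  · rintro τ k k' l hτ rfl rfl hl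
    exact ⟨modulus_sq_add_comodulus_sq hτ, modulus_ne_zero hτ, comodulus_ne_zero hτ,
      (modulus_add_one hτ).trans hl.symm, comodulus_add_one τ, translation_transformation
        (jacobiTriple_modulus hτ) (jacobiTriple_I_mul_modulus_div hτ hl)
        (modulus_sq_add_comodulus_sq hτ) (comodulus_ne_zero hτ) hl⟩
  · rintro τ k k' hτ rfl rfl
    exact ⟨fun T => isWittRealization_families_comodulus hτ T, cFamily_elliptic_changeVar_I
      (jacobiTriple_modulus hτ) (jacobiTriple_comodulus hτ) (modulus_sq_add_comodulus_sq hτ)⟩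
  · rintro τ k k' hτ rfl rfl T
    have hchange := dFamily_changeVar (jacobiTriple_modulus hτ)
      (jacobiTriple_I_mul_modulus_div hτ rfl) (modulus_sq_add_comodulus_sq hτ)
      (comodulus_ne_zero hτ) rfl T
    exact ⟨hchange, hchange ▸ (isWittRealization_dFamily (jacobiTriple_modulus hτ) T).changeVar
      (comodulus_ne_zero hτ)⟩

theorem mainTheorem3 :
    -- the Jacobi functions depend on `τ` only through the modulus
    (∀ τ : ℂ, 0 < τ.im →
      sn (modulus τ) = snTau τ ∧ cn (modulus τ) = cnTau τ ∧ dn (modulus τ) = dnTau τ) ∧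
    -- every `k ∈ (0, 1)` is a modulus, with complementary modulus `√(1 - k²)`
    (∀ k : ℝ, 0 < k → k < 1 → ∃ t : ℝ, 0 < t ∧
      modulus (I * (t : ℂ)) = (k : ℂ) ∧ comodulus (I * (t : ℂ)) = ((√(1 - k ^ 2) : ℝ) : ℂ)) ∧
    -- the transformation `τ ↦ -1/τ`
    (∀ τ k k' : ℂ, 0 < τ.im → k = modulus τ → k' = comodulus τ →
      modulus (-1 / τ) = k' ∧ comodulus (-1 / τ) = k ∧
      ∀ z : ℂ,
        sc k' z = -I * sn k (I * z) ∧ nc k' z = cn k (I * z) ∧ dc k' z = dn k (I * z) ∧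
        cs k' z = I * ns k (I * z) ∧ ds k' z = I * ds k (I * z) ∧ ns k' z = I * cs k (I * z) ∧
        nd k' z = cd k (I * z) ∧ cd k' z = nd k (I * z) ∧ sd k' z = -I * sd k (I * z) ∧
        cn k' z = nc k (I * z) ∧ sn k' z = -I * sc k (I * z) ∧ dn k' z = dc k (I * z)) ∧
    -- the transformation `τ ↦ τ + 1`
    (∀ τ k k' l : ℂ, 0 < τ.im → k = modulus τ → k' = comodulus τ → l = I * k / k' →
      k ^ 2 + k' ^ 2 = 1 ∧ k ≠ 0 ∧ k' ≠ 0 ∧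
      modulus (τ + 1) = l ∧ comodulus (τ + 1) = 1 / k' ∧
      ∀ z : ℂ,
        sd k z = sn l (k' * z) / k' ∧ cd k z = cn l (k' * z) ∧ nd k z = dn l (k' * z)) ∧
    -- realizations with modulus `k'`, in the variable `z` and in the variable `ζ = iz`
    (∀ k k' : ℝ, 0 < k → k < 1 → k' = √(1 - k ^ 2) →
      (∀ T : CKType,
        IsWittRealization T (basicFamily k' k T) ∧
        IsWittRealization T (cFamily k' T) ∧
        IsWittRealization T (sFamily k' k T) ∧
        IsWittRealization T (dFamily k' T) ∧
        IsWittRealization T ((basicFamily k' k T).changeVar I) ∧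
        IsWittRealization T ((cFamily k' T).changeVar I) ∧
        IsWittRealization T ((sFamily k' k T).changeVar I) ∧
        IsWittRealization T ((dFamily k' T).changeVar I)) ∧
      (cFamily k' .elliptic).changeVar I =
        ⟨fun ζ => -(1 / (k' : ℂ)) * dn k ζ, fun ζ => I * (1 / (k' : ℂ)) * cn k ζ,
          fun ζ => I * sn k ζ⟩) ∧
    -- realizations with modulus `λ = ik/k'`, in the variable `u = k'z`
    (∀ k k' : ℝ, 0 < k → k < 1 → k' = √(1 - k ^ 2) → ∀ T : CKType,
      (dFamily k T).changeVar k' = lambdaFamily (I * k / k') k' T ∧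
      IsWittRealization T (lambdaFamily (I * k / k') k' T)) ∧
    -- the absolute values of these moduli `λ` fill `(0, ∞)`
    (fun k : ℝ => ‖I * (k : ℂ) / ((√(1 - k ^ 2) : ℝ) : ℂ)‖) '' Set.Ioo 0 1 = Set.Ioi 0 := by
  obtain ⟨htau, hexists, himaginary, htranslate, hfamilies, hlambda, himage⟩ := mainTheorem3_general
  refine ⟨htau, hexists, himaginary, htranslate, ?_, ?_, himage⟩
  all_goals
    rintro k _ h0 h1 rfl
    obtain ⟨t, ht, hk, hk'⟩ := hexists k h0 h1
  · exact hfamilies (I * t) k _ (by simpa using ht) hk.symm hk'.symm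
  · exact hlambda (I * t) k _ (by simpa using ht) hk.symm hk'.symm
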